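/- Let $k\ge 2$ be an integer and let $$\Psi_{k+1}(x_1,\dots,x_{k+1})=\frac1{k+1}\sum_{j=1}^{k+1}\Big(\mathbf 1\{|\min_{i\ne j}x_i|<|x_j|\}-\mathbf 1\{|\max_{i\ne j}x_i|<|x_j|\}\Big),$$ $$I_n^{(k+1)}=\binom n{k+1}^{-1}\sum_{1\le i_1<\dots<i_{k+1}\le n}\Psi_{k+1}(X_{i_1},\dots,X_{i_{k+1}}).$$ (1) Let $X_1,\dots,X_{k+1}$ be independent and uniformly distributed on $[-1,1]$. For $s\in[-1,1]$ the projection $\psi_{k+1}(s)=\mathbb E\,\Psi_{k+1}(s,X_2,\dots,X_{k+1})$ is $$\psi_{k+1}(s)=\pm\frac{(1+s)^k+(1-s)^k-2}{(k+1)2^{k-1}},$$ with sign $+$ for $s>0$ and $-$ for $s\le 0$; moreover $\mathbb E[\Psi_{k+1}(X_1,\dots,X_{k+1})\mid X_j]=\psi_{k+1}(X_j)$ almost surely for each $j$. (2) The variance of $\psi_{k+1}(X_1)$ equals $\sigma_{k+1}^2:=\mathbb E\,\psi_{k+1}^2(X_1)$, and $$\sigma_{k+1}^2=\frac1{2^{2k-2}(k+1)^2}\int_0^1\big((1+s)^k+(1-s)^k-2\big)^2\,ds>0.$$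 In particular $\sigma_3^2=\frac1{45}$, $\sigma_4^2=\frac9{320}$, $\sigma_5^2=\frac{2843}{126000}$, $\sigma_6^2=\frac{2335}{145152}$, $\sigma_7^2=\frac{421691}{37669632}$. (3) Let now $X_1,X_2,\dots$ be i.i.d. real random variables whose distribution function $F$ satisfies $1-F(x)-F(-x)=0$ for all $x\in\mathbb R$ (the hypothesis $H_0$). Then, as $n\to\infty$, $\sqrt n\,I_n^{(k+1)}$ converges in distribution to $N(0,(k+1)^2\sigma_{k+1}^2)$, where $\sigma_{k+1}^2$ is as in (2). In particular $\sqrt n\,I_n^{(3)}\to N(0,\frac15)$ in distribution. -/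

import Mathlib

open MeasureTheory ProbabilityTheory Filter

noncomputable section

/-- The null hypothesis of symmetry about zero, `1 - F(x) - F(-x) = 0` for every real `x`,
where `F` is the distribution function of the law `P`. -/
def SymmetryHypothesis (P : Measure ℝ) : Prop :=
  ∀ x : ℝ, 1 - cdf P x - cdf P (-x) = 0

/-- The uniform distribution on `[-1, 1]`. -/
def symmUniform : Measure ℝ := ProbabilityTheory.cond volume (Set.Icc (-1 : ℝ) 1)

instance : IsProbabilityMeasure symmUniform :=
  cond_isProbabilityMeasure_of_finite (by simp) (by simp)

/-- The minimum of all the coordinates of `x` except the `j`-th one (used for `1 ≤ k`). -/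
def minExcept {k : ℕ} (x : Fin (k + 1) → ℝ) (j : Fin (k + 1)) : ℝ :=
  ⨅ i : Fin k, x (j.succAbove i)

/-- The maximum of all the coordinates of `x` except the `j`-th one (used for `1 ≤ k`). -/
def maxExcept {k : ℕ} (x : Fin (k + 1) → ℝ) (j : Fin (k + 1)) : ℝ :=
  ⨆ i : Fin k, x (j.succAbove i)

open Classical in
/-- The symmetrized kernel `Ψ_{k+1}`, of degree `k + 1`. -/
def symmKernel (k : ℕ) (x : Fin (k + 1) → ℝ) : ℝ :=
  ((k : ℝ) + 1)⁻¹ * ((∑ j : Fin (k + 1), if |minExcept x j| < |x j| then (1 : ℝ) else 0)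
    - ∑ j : Fin (k + 1), if |maxExcept x j| < |x j| then (1 : ℝ) else 0)

open Classical in
/-- The `U`-statistic of degree `m` with kernel `Ψ` of the first `n` terms of the sequence `x`:
the average of `Ψ (x_{i_1}, …, x_{i_m})` over all `i_1 < … < i_m` among the first `n` indices
(indices start at `0`). -/
def uStatistic {m : ℕ} (Ψ : (Fin m → ℝ) → ℝ) (n : ℕ) (x : ℕ → ℝ) : ℝ :=
  ((n.choose m : ℕ) : ℝ)⁻¹ *
    ∑ i : Fin m → Fin n with StrictMono i, Ψ (fun j => x (i j))

/-- The statistic `I_n^{(k+1)}`, evaluated at the sample `x_0, …, x_{n-1}`. -/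
def integralStatistic (k n : ℕ) (x : ℕ → ℝ) : ℝ :=
  uStatistic (symmKernel k) n x

/-- The one-dimensional projection `ψ(s) = E[Ψ(X_1, …, X_{m+1}) | X_1 = s]` of a kernel `Ψ` for
independent `X_i` with law `P`. -/
def projection (P : Measure ℝ) {m : ℕ} (Ψ : (Fin (m + 1) → ℝ) → ℝ) (s : ℝ) : ℝ :=
  ∫ y : Fin m → ℝ, Ψ (Fin.cons s y) ∂(Measure.pi fun _ : Fin m => P)

/-- `σ²_{k+1} = E ψ_{k+1}(X_1)²` for `X_1` uniform on `[-1, 1]`, with `ψ_{k+1}` the projection of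
the kernel `Ψ_{k+1}`. -/
def sigmaSq (k : ℕ) : ℝ :=
  ∫ s, (projection symmUniform (symmKernel k) s) ^ 2 ∂symmUniform

end

/-!
The statistic `I_n^{(k+1)}` is a `U`-statistic with a bounded symmetric kernel, so everything rests
on the projection of the kernel onto one variable.

*The projection.* Fix the first variable `s` and let the others be uniform on `[-1, 1]`. In the
summand where `s` itself is compared with the minimum and with the maximum of the others, the two
indicators have the same mean, since that minimum and that maximum are equal in law up to sign. In
every other summand fix in addition the value `z` of the variable that is compared, and put
`t = |z|`. For the remaining `k - 1` variables and `s`, the event that the minimum or maximum has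
absolute value below `t` is a difference of two product events (`ite_abs_iSup_lt_eq`,
`ite_abs_iInf_lt_eq`), and the probabilities for the minimum and the maximum cancel unless
`t ≤ |s|`. What is left is `±(((1 + t) / 2) ^ (k - 1) - ((1 - t) / 2) ^ (k - 1))` with the sign of
`s` (`integral_symmKernel_summand_succ`). Since `t` is uniform on `[0, 1]`, an integration over
`[0, |s|]` gives the closed form `projection_symmUniform_eq`. It is odd in `s`, so the projection
has mean zero and its variance is `sigmaSq k`.

*The limit law.* Subtracting the projections from the kernel leaves a degenerate kernel. Two of its
evaluations at index tuples with at most one common index are uncorrelated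
(`integral_mul_eq_zero_of_degenerate`), and only a fraction `O(n⁻²)` of the pairs of tuples share
two or more indices (`card_filter_strictMono_two_le_card_inter_le`). Hence the `U`-statistic differs
by `O(n⁻¹)` in `L²` from `(k + 1) / n` times a sum of i.i.d. projections, and the classical central
limit theorem applies (`tendstoInDistribution_sqrt_mul_uStatistic`).

*Freedom from the distribution.* Under the symmetry hypothesis the distribution function `F` is
continuous and `G = 2F - 1` is odd, monotone and transforms the sample into a uniform one
(`map_two_mul_cdf_sub_one`). The kernel is unchanged by `G` as long as the absolute values of the
transformed entries are distinct (`symmKernel_comp_eq`), which holds almost surely.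
-/

/-! ### Counting increasing tuples -/

section Tuples

lemma StrictMono.eq_of_image_univ_eq {m n : ℕ} {i i' : Fin m → Fin n} (hi : StrictMono i)
    (hi' : StrictMono i') (h : Finset.univ.image i = Finset.univ.image i') : i = i' := by
  have hc : (Finset.univ.image i).card = m := by
    rw [Finset.card_image_of_injective _ hi.injective, Finset.card_fin]
  exact (Finset.orderEmbOfFin_unique hc
    (fun x => Finset.mem_image_of_mem _ (Finset.mem_univ x)) hi).trans
    (Finset.orderEmbOfFin_unique hc
      (fun x => h ▸ Finset.mem_image_of_mem _ (Finset.mem_univ x)) hi').symm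

open Classical in
/-- Strictly increasing tuples correspond to subsets through their range. -/
lemma card_filter_strictMono_image {m n : ℕ} (p : Finset (Fin n) → Prop)
    [DecidablePred p] :
    (Finset.univ.filter fun i : Fin m → Fin n => StrictMono i ∧ p (Finset.univ.image i)).card =
      ((Finset.univ.powersetCard m).filter p).card := by
  refine Finset.card_bij (fun i _ => Finset.univ.image i) ?_ ?_ ?_
  · intro i hi
    obtain ⟨hi, hp⟩ := (Finset.mem_filter.1 hi).2
    refine Finset.mem_filter.2 ⟨Finset.mem_powersetCard.2 ⟨Finset.subset_univ _, ?_⟩, hp⟩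
    rw [Finset.card_image_of_injective _ hi.injective, Finset.card_fin]
  · intro i hi i' hi' h
    exact (Finset.mem_filter.1 hi).2.1.eq_of_image_univ_eq (Finset.mem_filter.1 hi').2.1 h
  · intro A hA
    obtain ⟨hA, hp⟩ := Finset.mem_filter.1 hA
    have hc := (Finset.mem_powersetCard.1 hA).2
    have him : Finset.univ.image (A.orderEmbOfFin hc) = A := by
      apply Finset.coe_injective
      simp
    refine ⟨A.orderEmbOfFin hc, ?_, him⟩
    exact Finset.mem_filter.2 ⟨Finset.mem_univ _, (A.orderEmbOfFin hc).strictMono, him.symm ▸ hp⟩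

open Classical in
lemma card_filter_strictMono (m n : ℕ) :
    (Finset.univ.filter fun i : Fin m → Fin n => StrictMono i).card = n.choose m := by
  simpa using card_filter_strictMono_image (m := m) (n := n) (fun _ => True)

/-- The number of sets of size `m` that contain a given set `T`. -/
lemma Finset.card_filter_superset_powersetCard {α : Type*} [Fintype α] [DecidableEq α]
    (T : Finset α) {m : ℕ} (hT : T.card ≤ m) :
    (((Finset.univ : Finset α).powersetCard m).filter fun B => T ⊆ B).card =
      (Fintype.card α - T.card).choose (m - T.card) := by
  have : ((Finset.univ \ T).powersetCard (m - T.card)).card =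
      (Fintype.card α - T.card).choose (m - T.card) := by
    rw [Finset.card_powersetCard, Finset.card_sdiff_of_subset (Finset.subset_univ _),
      Finset.card_univ]
  rw [← this]
  refine Finset.card_bij' (fun B _ => B \ T) (fun B _ => B ∪ T) ?_ ?_ ?_ ?_
  · intro B hB
    obtain ⟨hB, hTB⟩ := Finset.mem_filter.1 hB
    rw [Finset.mem_powersetCard] at hB ⊢
    exact ⟨Finset.sdiff_subset_sdiff (Finset.subset_univ _) le_rfl, by
      rw [Finset.card_sdiff_of_subset hTB, hB.2]⟩
  · intro B hB
    rw [Finset.mem_powersetCard] at hB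
    have hd : Disjoint B T := Finset.disjoint_of_subset_left hB.1 Finset.sdiff_disjoint
    refine Finset.mem_filter.2 ⟨Finset.mem_powersetCard.2 ⟨Finset.subset_univ _, ?_⟩,
      Finset.subset_union_right⟩
    rw [Finset.card_union_of_disjoint hd, hB.2]
    omega
  · intro B hB
    exact Finset.sdiff_union_of_subset (Finset.mem_filter.1 hB).2
  · intro B hB
    rw [Finset.mem_powersetCard] at hB
    have hd : Disjoint B T := Finset.disjoint_of_subset_left hB.1 Finset.sdiff_disjoint
    exact Finset.union_sdiff_cancel_right hd

open Classical in
lemma card_filter_strictMono_mem_range {m n : ℕ} (l : Fin n) :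
    (Finset.univ.filter fun i : Fin (m + 1) → Fin n =>
      StrictMono i ∧ l ∈ Finset.univ.image i).card = (n - 1).choose m := by
  rw [card_filter_strictMono_image fun B => l ∈ B]
  have := Finset.card_filter_superset_powersetCard {l} (m := m + 1) (by simp)
  simpa using this

open Classical in
/-- A given set of size `m` meets at most `C(m, 2) C(n - 2, m - 2)` sets of size `m` in two or more
points: choose two common points, then a superset of them. -/
lemma card_filter_strictMono_two_le_card_inter_le {m n : ℕ} (A : Finset (Fin n))
    (hA : A.card = m) :
    (Finset.univ.filter fun i : Fin m → Fin n =>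
      StrictMono i ∧ 2 ≤ (A ∩ Finset.univ.image i).card).card ≤
      m.choose 2 * (n - 2).choose (m - 2) := by
  rw [card_filter_strictMono_image fun B => 2 ≤ (A ∩ B).card]
  have hsub : ((Finset.univ.powersetCard m).filter fun B : Finset (Fin n) => 2 ≤ (A ∩ B).card) ⊆
      (A.powersetCard 2).biUnion fun T =>
        (Finset.univ.powersetCard m).filter fun B : Finset (Fin n) => T ⊆ B := by
    intro B hB
    obtain ⟨hB, h2⟩ := Finset.mem_filter.1 hB
    obtain ⟨T, hT, hTc⟩ := Finset.exists_subset_card_eq h2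
    exact Finset.mem_biUnion.2 ⟨T, Finset.mem_powersetCard.2
      ⟨hT.trans Finset.inter_subset_left, hTc⟩,
      Finset.mem_filter.2 ⟨hB, hT.trans Finset.inter_subset_right⟩⟩
  refine (Finset.card_le_card hsub).trans ?_
  rw [← hA, ← Finset.card_powersetCard]
  refine Finset.card_biUnion_le_card_mul _ _ _ fun T hT => ?_
  obtain ⟨hTA, hT2⟩ := Finset.mem_powersetCard.1 hT
  rw [Finset.card_filter_superset_powersetCard T (Finset.card_le_card hTA), hT2, Fintype.card_fin]

end Tuples

/-! ### Projections and the remainder of the Hoeffding decomposition -/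

section Projection

variable {m : ℕ} {P : Measure ℝ} {Ψ : (Fin (m + 1) → ℝ) → ℝ} {C : ℝ}

lemma measurable_insertNth (r : Fin (m + 1)) :
    Measurable fun p : ℝ × (Fin m → ℝ) => (r.insertNth p.1 p.2 : Fin (m + 1) → ℝ) :=
  (MeasurableEquiv.piFinSuccAbove (fun _ => ℝ) r).symm.measurable

lemma measurable_cons :
    Measurable fun p : ℝ × (Fin m → ℝ) => (Fin.cons p.1 p.2 : Fin (m + 1) → ℝ) := by
  simpa using measurable_insertNth (m := m) 0

lemma integral_pi_eq_integral_integral_insertNth [IsProbabilityMeasure P] (r : Fin (m + 1))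
    {f : (Fin (m + 1) → ℝ) → ℝ} (hf : Integrable f (Measure.pi fun _ : Fin (m + 1) => P)) :
    ∫ x, f x ∂(Measure.pi fun _ : Fin (m + 1) => P) =
      ∫ s, ∫ y, f (r.insertNth s y) ∂(Measure.pi fun _ : Fin m => P) ∂P := by
  have h := (measurePreserving_piFinSuccAbove (fun _ : Fin (m + 1) => P) r).symm
  rw [← h.integral_comp', integral_prod]
  · rfl
  · exact h.integrable_comp_of_integrable hf

lemma measurable_projection [IsProbabilityMeasure P] (hΨ : Measurable Ψ) :
    Measurable (projection P Ψ) := by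
  unfold projection
  exact ((hΨ.comp measurable_cons).stronglyMeasurable.integral_prod_right'
    (f := fun p : ℝ × (Fin m → ℝ) => Ψ (Fin.cons p.1 p.2))).measurable

lemma abs_projection_le [IsProbabilityMeasure P] (hC : ∀ x, |Ψ x| ≤ C) (s : ℝ) :
    |projection P Ψ s| ≤ C := by
  have := norm_integral_le_of_norm_le_const (μ := Measure.pi fun _ : Fin m => P)
    (f := fun y => Ψ (Fin.cons s y)) (C := C) (Eventually.of_forall fun y => hC _)
  simpa [projection] using this

lemma MeasureTheory.Integrable.of_abs_le {α : Type*} [MeasurableSpace α] {μ : Measure α}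
    [IsFiniteMeasure μ] {f : α → ℝ} (hf : Measurable f) (hC : ∀ x, |f x| ≤ C) :
    Integrable f μ :=
  Integrable.of_bound hf.aestronglyMeasurable C (Eventually.of_forall hC)

/-- A symmetric kernel has the same projection onto each of its variables. -/
lemma integral_insertNth_eq_projection (hsymm : ∀ (σ : Equiv.Perm (Fin (m + 1))) x, Ψ (x ∘ σ) = Ψ x)
    (r : Fin (m + 1)) (s : ℝ) :
    ∫ y, Ψ (r.insertNth s y) ∂(Measure.pi fun _ : Fin m => P) = projection P Ψ s := by
  simp_rw [projection, ← Fin.cons_comp_cycleRange, hsymm]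

/-- The part of the kernel `Ψ` that is not accounted for by its one-dimensional projections: the
second- and higher-order terms of the Hoeffding decomposition, for a kernel of mean zero. -/
noncomputable def hoeffdingRemainder (P : Measure ℝ) (Ψ : (Fin (m + 1) → ℝ) → ℝ)
    (x : Fin (m + 1) → ℝ) : ℝ :=
  Ψ x - ∑ j, projection P Ψ (x j)

lemma measurable_hoeffdingRemainder [IsProbabilityMeasure P] (hΨ : Measurable Ψ) :
    Measurable (hoeffdingRemainder P Ψ) :=
  hΨ.sub (Finset.measurable_sum _ fun j _ =>
    (measurable_projection hΨ).comp (measurable_pi_apply j))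

lemma abs_hoeffdingRemainder_le [IsProbabilityMeasure P] (hC : ∀ x, |Ψ x| ≤ C)
    (x : Fin (m + 1) → ℝ) : |hoeffdingRemainder P Ψ x| ≤ (m + 2) * C := by
  calc |hoeffdingRemainder P Ψ x| ≤ |Ψ x| + ∑ j, |projection P Ψ (x j)| :=
        (abs_sub _ _).trans (by gcongr; exact Finset.abs_sum_le_sum_abs _ _)
    _ ≤ C + ∑ j : Fin (m + 1), C := by
        gcongr
        · exact hC x
        · exact abs_projection_le hC _
    _ = (m + 2) * C := by simp; ring

/-- The remainder is degenerate: it integrates to zero given any one of its variables. -/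
lemma integral_hoeffdingRemainder_insertNth [IsProbabilityMeasure P] (hΨ : Measurable Ψ)
    (hC : ∀ x, |Ψ x| ≤ C)
    (hsymm : ∀ (σ : Equiv.Perm (Fin (m + 1))) x, Ψ (x ∘ σ) = Ψ x)
    (h0 : ∫ s, projection P Ψ s ∂P = 0) (r : Fin (m + 1)) (s : ℝ) :
    ∫ y, hoeffdingRemainder P Ψ (r.insertNth s y) ∂(Measure.pi fun _ : Fin m => P) = 0 := by
  have hψ := measurable_projection (P := P) hΨ
  have h1 : Integrable (fun y => Ψ (r.insertNth s y)) (Measure.pi fun _ : Fin m => P) :=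
    Integrable.of_abs_le (hΨ.comp ((measurable_insertNth r).comp measurable_prodMk_left))
      (C := C) fun y => hC _
  have h2 : ∀ q : Fin m, Integrable (fun y : Fin m → ℝ => projection P Ψ (y q))
      (Measure.pi fun _ : Fin m => P) := fun q =>
    Integrable.of_abs_le (hψ.comp (measurable_pi_apply q)) (C := C) fun y => abs_projection_le hC _
  have h3 : ∀ q : Fin m, ∫ y : Fin m → ℝ, projection P Ψ (y q) ∂(Measure.pi fun _ : Fin m => P)
      = 0 := fun q => by
    rw [integral_comp_eval (μ := fun _ : Fin m => P) (i := q) hψ.aestronglyMeasurable, h0]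
  simp only [hoeffdingRemainder, Fin.sum_univ_succAbove _ r, Fin.insertNth_apply_same,
    Fin.insertNth_apply_succAbove]
  have h4 : Integrable (fun y : Fin m → ℝ => ∑ q, projection P Ψ (y q))
      (Measure.pi fun _ : Fin m => P) := integrable_finsetSum _ fun q _ => h2 q
  have h5 : Integrable (fun y : Fin m → ℝ => projection P Ψ s + ∑ q, projection P Ψ (y q))
      (Measure.pi fun _ : Fin m => P) := (integrable_const _).add h4
  rw [integral_sub h1 h5, integral_insertNth_eq_projection hsymm,
    integral_add (integrable_const _) h4, integral_finsetSum _ fun q _ => h2 q]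
  simp [h3]

end Projection

/-! ### Orthogonality of degenerate kernels -/

section Orthogonality

variable {Ω ι : Type*} [MeasurableSpace Ω] {μ : Measure Ω} [IsProbabilityMeasure μ]
  {P : Measure ℝ} {X : ι → Ω → ℝ} {m : ℕ}

lemma map_tuple_eq_pi (hlaw : ∀ i, HasLaw (X i) P μ) (hindep : iIndepFun X μ)
    {i : Fin m → ι} (hi : Function.Injective i) :
    μ.map (fun ω q => X (i q) ω) = Measure.pi fun _ : Fin m => P := by
  rw [(iIndepFun_iff_map_fun_eq_pi_map fun q => (hlaw (i q)).aemeasurable).1 (hindep.precomp hi)]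
  simp_rw [fun q => (hlaw (i q)).map_eq]

/-- A degenerate function of one tuple of independent variables is orthogonal to each function of
another tuple that shares at most one variable, namely that in position `r`, with it: the other
variables of the first tuple can be integrated out, given all those of the second. -/
lemma integral_mul_eq_zero_of_degenerate [IsProbabilityMeasure P]
    {f h : (Fin (m + 1) → ℝ) → ℝ} {C : ℝ} (hX : ∀ i, Measurable (X i))
    (hlaw : ∀ i, HasLaw (X i) P μ) (hindep : iIndepFun X μ) (hf : Measurable f)
    (hh : Measurable h) (hfC : ∀ x, |f x| ≤ C) (hhC : ∀ x, |h x| ≤ C)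
    {i i' : Fin (m + 1) → ι} (hi' : Function.Injective i') (r : Fin (m + 1))
    (hdeg : ∀ s, ∫ y, h (r.insertNth s y) ∂(Measure.pi fun _ : Fin m => P) = 0)
    (hr : ∀ q, q ≠ r → ∀ p, i p ≠ i' q) :
    ∫ ω, f (fun p => X (i p) ω) * h (fun p => X (i' p) ω) ∂μ = 0 := by
  classical
  -- All variables of `f`, together with the one in position `r`, are independent of the remaining
  -- variables of `h`, so the joint law is a product and Fubini's theorem applies.
  set S : Finset ι := insert (i' r) (Finset.univ.image i) with hS
  set T : Finset ι := Finset.univ.image (i' ∘ r.succAbove) with hT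
  have hST : Disjoint S T := by
    rw [Finset.disjoint_left]
    intro a haS haT
    obtain ⟨q, -, rfl⟩ := Finset.mem_image.1 haT
    rcases Finset.mem_insert.1 haS with h | h
    · exact Fin.succAbove_ne r q (hi' h)
    · obtain ⟨p, -, hp⟩ := Finset.mem_image.1 h
      exact hr _ (Fin.succAbove_ne r q) p hp
  have hiS : ∀ p, i p ∈ S := fun p =>
    Finset.mem_insert_of_mem (Finset.mem_image_of_mem _ (Finset.mem_univ p))
  have hrS : i' r ∈ S := Finset.mem_insert_self _ _
  have hqT : ∀ q, i' (r.succAbove q) ∈ T := fun q =>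
    Finset.mem_image.2 ⟨q, Finset.mem_univ _, rfl⟩
  let u : (S → ℝ) → (Fin (m + 1) → ℝ) × ℝ := fun z => (fun p => z ⟨i p, hiS p⟩, z ⟨i' r, hrS⟩)
  let v : (T → ℝ) → Fin m → ℝ := fun z q => z ⟨_, hqT q⟩
  have hind := (hindep.indepFun_finset S T hST hX).comp (φ := u) (ψ := v)
    (by fun_prop) (by fun_prop)
  have hU : Measurable fun ω => ((fun p => X (i p) ω : Fin (m + 1) → ℝ), X (i' r) ω) := by fun_prop
  have hV : Measurable fun ω => (fun q => X (i' (r.succAbove q)) ω : Fin m → ℝ) := by fun_prop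
  have hmap := (indepFun_iff_map_prod_eq_prod_map_map hU.aemeasurable hV.aemeasurable).1 hind
  rw [map_tuple_eq_pi (i := fun q => i' (r.succAbove q)) hlaw hindep
    (hi'.comp Fin.succAbove_right_injective)] at hmap
  set g : ((Fin (m + 1) → ℝ) × ℝ) × (Fin m → ℝ) → ℝ := fun p =>
    f p.1.1 * h (r.insertNth p.1.2 p.2) with hg
  have hgm : Measurable g := by
    refine (hf.comp (by fun_prop)).mul (hh.comp ((measurable_insertNth r).comp
      (f := fun p : ((Fin (m + 1) → ℝ) × ℝ) × (Fin m → ℝ) => (p.1.2, p.2)) (by fun_prop)))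
  have heq : ∀ ω, f (fun p => X (i p) ω) * h (fun p => X (i' p) ω) =
      g (((fun p => X (i p) ω), X (i' r) ω), fun q => X (i' (r.succAbove q)) ω) := by
    intro ω
    simp only [hg]
    congr 2
    exact (Fin.insertNth_self_removeNth r (fun p => X (i' p) ω)).symm
  simp_rw [heq]
  have := Measure.isProbabilityMeasure_map (μ := μ) hU.aemeasurable
  rw [← integral_map (φ := fun ω => (((fun p => X (i p) ω : Fin (m + 1) → ℝ), X (i' r) ω),
      (fun q => X (i' (r.succAbove q)) ω : Fin m → ℝ))) (f := g) (hU.prodMk hV).aemeasurable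
      hgm.aestronglyMeasurable, hmap, integral_prod]
  · simp [hg, integral_const_mul, hdeg]
  · refine Integrable.of_abs_le hgm (C := C * C) fun p => ?_
    rw [hg, abs_mul]
    exact mul_le_mul (hfC _) (hhC _) (abs_nonneg _) ((abs_nonneg _).trans (hfC p.1.1))

end Orthogonality

/-! ### The central limit theorem for `U`-statistics -/

section UStatistic

variable {m : ℕ}

/-- The average over all increasing tuples of the sum of `ψ` over the entries is a multiple of the
sum of `ψ` over the sample, each index occurring in `C(n - 1, m)` tuples of size `m + 1`. -/
lemma uStatistic_sum_eq (ψ : ℝ → ℝ) {n : ℕ} (hn : m + 1 ≤ n) (x : ℕ → ℝ) :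
    uStatistic (m := m + 1) (fun y => ∑ j, ψ (y j)) n x =
      ((m : ℝ) + 1) / n * ∑ l ∈ Finset.range n, ψ (x l) := by
  classical
  have hterm : ∀ i ∈ Finset.univ.filter (fun i : Fin (m + 1) → Fin n => StrictMono i),
      ∑ j, ψ (x (i j)) = ∑ l : Fin n, if l ∈ Finset.univ.image i then ψ (x l) else 0 := by
    intro i hi
    rw [← Finset.sum_filter, Finset.filter_mem_eq_inter, Finset.univ_inter,
      Finset.sum_image (Finset.mem_filter.1 hi).2.injective.injOn]
  have hcount : ∀ l : Fin n, (∑ i : Fin (m + 1) → Fin n with StrictMono i,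
      if l ∈ Finset.univ.image i then ψ (x l) else 0) = ((n - 1).choose m : ℕ) * ψ (x l) := by
    intro l
    rw [← Finset.sum_filter, Finset.filter_filter, Finset.sum_const, nsmul_eq_mul]
    congr 2
    convert card_filter_strictMono_mem_range (m := m) l
  have hchoose : ((n.choose (m + 1) : ℕ) : ℝ) * (m + 1) = n * ((n - 1).choose m : ℕ) := by
    obtain ⟨n, rfl⟩ : ∃ n', n = n' + 1 := ⟨n - 1, by omega⟩
    exact_mod_cast (Nat.add_one_mul_choose_eq n m).symm
  have hpos : ((n.choose (m + 1) : ℕ) : ℝ) ≠ 0 := by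
    exact_mod_cast (Nat.choose_pos hn).ne'
  have hn0 : (n : ℝ) ≠ 0 := by
    exact_mod_cast (by omega : n ≠ 0)
  have hall : ∑ i : Fin (m + 1) → Fin n with StrictMono i, ∑ j, ψ (x (i j)) =
      ((n - 1).choose m : ℕ) * ∑ l ∈ Finset.range n, ψ (x l) := by
    rw [Finset.sum_congr rfl hterm, Finset.sum_comm, Finset.sum_congr rfl fun l _ => hcount l,
      ← Finset.mul_sum, Fin.sum_univ_eq_sum_range (fun l => ψ (x l))]
  unfold uStatistic
  have hall' : ∑ i : Fin (m + 1) → Fin n with StrictMono i, (fun y : Fin (m + 1) → ℝ =>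
      ∑ j, ψ (y j)) (fun j => x (i j)) =
      ((n - 1).choose m : ℕ) * ∑ l ∈ Finset.range n, ψ (x l) := by
    convert hall
  rw [hall']
  field_simp
  linear_combination (-∑ l ∈ Finset.range n, ψ (x l)) * hchoose

/-- The Hoeffding decomposition of a `U`-statistic into its linear part and the `U`-statistic of
the remainder kernel. -/
lemma uStatistic_eq_sum_projection_add (P : Measure ℝ) (Ψ : (Fin (m + 1) → ℝ) → ℝ) {n : ℕ}
    (hn : m + 1 ≤ n) (x : ℕ → ℝ) :
    uStatistic Ψ n x = ((m : ℝ) + 1) / n * ∑ l ∈ Finset.range n, projection P Ψ (x l) +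
      uStatistic (hoeffdingRemainder P Ψ) n x := by
  rw [← uStatistic_sum_eq (projection P Ψ) hn x]
  simp only [uStatistic, ← mul_add, ← Finset.sum_add_distrib, hoeffdingRemainder,
    add_sub_cancel]

lemma measurable_uStatistic {Ω : Type*} [MeasurableSpace Ω] {X : ℕ → Ω → ℝ}
    {Ψ : (Fin m → ℝ) → ℝ} (hΨ : Measurable Ψ) (hX : ∀ i, Measurable (X i)) (n : ℕ) :
    Measurable fun ω => uStatistic Ψ n (fun i => X i ω) := by
  unfold uStatistic
  refine measurable_const.mul (Finset.measurable_sum _ fun i _ => ?_)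
  exact hΨ.comp (by fun_prop)

lemma abs_uStatistic_le {Ψ : (Fin m → ℝ) → ℝ} {C : ℝ} (hC : ∀ x, |Ψ x| ≤ C) (n : ℕ)
    (x : ℕ → ℝ) : |uStatistic Ψ n x| ≤ C := by
  classical
  have hC0 : 0 ≤ C := (abs_nonneg _).trans (hC 0)
  have h : |∑ i : Fin m → Fin n with StrictMono i, Ψ (fun j => x (i j))| ≤
      ((n.choose m : ℕ) : ℝ) * C := by
    rw [← card_filter_strictMono m n, ← nsmul_eq_mul]
    refine (Finset.abs_sum_le_sum_abs _ _).trans ?_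
    convert Finset.sum_le_card_nsmul _ (fun i : Fin m → Fin n => |Ψ fun j => x (i j)|) C
      fun i _ => hC _
  unfold uStatistic
  rw [abs_mul, abs_inv, Nat.abs_cast]
  rcases Nat.eq_zero_or_pos (n.choose m) with h0 | h0
  · simpa [h0] using hC0
  · rw [inv_mul_le_iff₀ (by exact_mod_cast h0)]
    convert h

variable {Ω : Type*} [MeasurableSpace Ω] {μ : Measure Ω} [IsProbabilityMeasure μ]
  {P : Measure ℝ} [IsProbabilityMeasure P] {X : ℕ → Ω → ℝ}

/-- The second moment of a `U`-statistic with degenerate kernel is of order `n⁻²`: only the pairs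
of index tuples with at least two common indices contribute. -/
lemma integral_uStatistic_sq_le {h : (Fin (m + 1) → ℝ) → ℝ} {C : ℝ}
    (hX : ∀ i, Measurable (X i)) (hlaw : ∀ i, HasLaw (X i) P μ) (hindep : iIndepFun X μ)
    (hh : Measurable h) (hC : ∀ x, |h x| ≤ C)
    (hdeg : ∀ r s, ∫ y, h (Fin.insertNth r s y) ∂(Measure.pi fun _ : Fin m => P) = 0)
    {n : ℕ} (hn : m + 1 ≤ n) (hn2 : 2 ≤ n) :
    ∫ ω, (uStatistic h n fun i => X i ω) ^ 2 ∂μ ≤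
      C ^ 2 * ((m + 1).choose 2 : ℕ) ^ 2 / (n.choose 2 : ℕ) := by
  classical
  set I := Finset.univ.filter fun i : Fin (m + 1) → Fin n => StrictMono i with hI
  set N : ℝ := ((n.choose (m + 1) : ℕ) : ℝ) with hN
  have hNpos : 0 < N := by
    rw [hN]
    exact_mod_cast Nat.choose_pos hn
  have hIcard : (I.card : ℝ) = N := by rw [hI, hN, card_filter_strictMono]
  have hmeas : ∀ i : Fin (m + 1) → Fin n, Measurable fun ω => h (fun p => X (i p) ω) :=
    fun i => hh.comp (by fun_prop)
  have hint : ∀ i i' : Fin (m + 1) → Fin n,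
      Integrable (fun ω => h (fun p => X (i p) ω) * h (fun p => X (i' p) ω)) μ := fun i i' =>
    Integrable.of_abs_le ((hmeas i).mul (hmeas i')) (C := C * C) fun ω => by
      rw [abs_mul]
      exact mul_le_mul (hC _) (hC _) (abs_nonneg _) ((abs_nonneg _).trans (hC 0))
  have hexp : ∀ ω, (uStatistic h n fun i => X i ω) ^ 2 =
      N⁻¹ ^ 2 * ∑ i ∈ I, ∑ i' ∈ I, h (fun p => X (i p) ω) * h (fun p => X (i' p) ω) := by
    intro ω
    unfold uStatistic
    rw [mul_pow, sq (Finset.sum _ _), Finset.sum_mul_sum]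
  -- Pairs with at most one common index contribute nothing, the others at most `C ^ 2`.
  have hpair : ∀ i ∈ I, ∀ i' ∈ I,
      ∫ ω, h (fun p => X (i p) ω) * h (fun p => X (i' p) ω) ∂μ ≤
        if 2 ≤ (Finset.univ.image i ∩ Finset.univ.image i').card then C ^ 2 else 0 := by
    intro i hi i' hi'
    have hi := (Finset.mem_filter.1 hi).2
    have hi' := (Finset.mem_filter.1 hi').2
    split_ifs with h2
    · have := norm_integral_le_of_norm_le_const (μ := μ) (C := C ^ 2)
        (f := fun ω => h (fun p => X (i p) ω) * h (fun p => X (i' p) ω))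
        (Eventually.of_forall fun ω => by
          rw [Real.norm_eq_abs, abs_mul, sq]
          exact mul_le_mul (hC _) (hC _) (abs_nonneg _) ((abs_nonneg _).trans (hC 0)))
      exact (le_abs_self _).trans (by simpa using this)
    · have h1 : (Finset.univ.image i ∩ Finset.univ.image i').card ≤ 1 := by omega
      obtain ⟨r, hr⟩ : ∃ r, ∀ q, q ≠ r → ∀ p, i p ≠ i' q := by
        by_cases hex : ∃ r p, i p = i' r
        · obtain ⟨r, p, hrp⟩ := hex
          refine ⟨r, fun q hq p' hp' => hq (hi'.injective ?_)⟩
          refine Finset.card_le_one.1 h1 _ ?_ _ ?_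
          · exact Finset.mem_inter.2 ⟨hp' ▸ Finset.mem_image_of_mem _ (Finset.mem_univ _),
              Finset.mem_image_of_mem _ (Finset.mem_univ _)⟩
          · exact Finset.mem_inter.2 ⟨hrp ▸ Finset.mem_image_of_mem _ (Finset.mem_univ _),
              Finset.mem_image_of_mem _ (Finset.mem_univ _)⟩
        · push Not at hex
          exact ⟨0, fun q _ p => hex q p⟩
      exact (integral_mul_eq_zero_of_degenerate (X := fun i : Fin n => X i) (i := i) (i' := i')
        (fun i => hX i) (fun i => hlaw i) (hindep.precomp Fin.val_injective) hh hh hC hC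
        hi'.injective r (hdeg r) hr).le
  have hrow : ∀ i ∈ I, (∑ i' ∈ I,
      if 2 ≤ (Finset.univ.image i ∩ Finset.univ.image i').card then C ^ 2 else 0) ≤
        ((m + 1).choose 2 * (n - 2).choose (m + 1 - 2) : ℕ) * C ^ 2 := by
    intro i hi
    have hi := (Finset.mem_filter.1 hi).2
    rw [← Finset.sum_filter, Finset.sum_const, nsmul_eq_mul, hI, Finset.filter_filter]
    gcongr
    have hc : (Finset.univ.image i).card = m + 1 := by
      rw [Finset.card_image_of_injective _ hi.injective, Finset.card_fin]
    convert card_filter_strictMono_two_le_card_inter_le (m := m + 1) _ hc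
  -- For `m = 0` both sides vanish, although the truncated `m + 1 - 2` is not the true difference.
  have hchoose : (n.choose 2 : ℝ) * ((m + 1).choose 2 * (n - 2).choose (m + 1 - 2) : ℕ) =
      N * ((m + 1).choose 2 : ℕ) ^ 2 := by
    rcases Nat.eq_zero_or_pos m with rfl | hm
    · simp
    · have := Nat.choose_mul (n := n) (k := m + 1) (s := 2) (by omega)
      have : (n.choose (m + 1) : ℝ) * ((m + 1).choose 2 : ℕ) =
          (n.choose 2 : ℕ) * ((n - 2).choose (m + 1 - 2) : ℕ) := by exact_mod_cast this
      rw [Nat.cast_mul]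
      linear_combination (-((m + 1).choose 2 : ℝ)) * this
  have hDpos : (0 : ℝ) < (n.choose 2 : ℕ) := by exact_mod_cast Nat.choose_pos hn2
  simp_rw [hexp]
  rw [integral_const_mul,
    integral_finsetSum _ fun i _ => integrable_finsetSum _ fun i' _ => hint i i']
  simp_rw [integral_finsetSum I fun i' _ => hint _ i']
  calc N⁻¹ ^ 2 * ∑ i ∈ I, ∑ i' ∈ I, ∫ ω, h (fun p => X (i p) ω) * h (fun p => X (i' p) ω) ∂μ
      ≤ N⁻¹ ^ 2 * ∑ i ∈ I, ((m + 1).choose 2 * (n - 2).choose (m + 1 - 2) : ℕ) * C ^ 2 := by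
        gcongr with i hi
        exact (Finset.sum_le_sum fun i' hi' => hpair i hi i' hi').trans (hrow i hi)
    _ = C ^ 2 * ((m + 1).choose 2 : ℕ) ^ 2 / (n.choose 2 : ℕ) := by
        rw [Finset.sum_const, nsmul_eq_mul, hIcard]
        field_simp
        linear_combination C ^ 2 * hchoose

/-- **Hoeffding's central limit theorem** for `U`-statistics with a bounded symmetric kernel of
mean zero. -/
theorem tendstoInDistribution_sqrt_mul_uStatistic {Ψ : (Fin (m + 1) → ℝ) → ℝ} {C : ℝ}
    (hX : ∀ i, Measurable (X i)) (hlaw : ∀ i, HasLaw (X i) P μ) (hindep : iIndepFun X μ)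
    (hΨ : Measurable Ψ) (hC : ∀ x, |Ψ x| ≤ C)
    (hsymm : ∀ (σ : Equiv.Perm (Fin (m + 1))) x, Ψ (x ∘ σ) = Ψ x)
    (h0 : ∫ s, projection P Ψ s ∂P = 0) :
    TendstoInDistribution (fun (n : ℕ) ω => √(n : ℝ) * uStatistic Ψ n fun i => X i ω) atTop
      (id : ℝ → ℝ) (fun _ => μ)
      (gaussianReal 0
        (Real.toNNReal (((m : ℝ) + 1) ^ 2 * ∫ s, (projection P Ψ s) ^ 2 ∂P))) := by
  have hψ := measurable_projection (P := P) hΨ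
  set Y : ℕ → Ω → ℝ := fun i ω => ((m : ℝ) + 1) * projection P Ψ (X i ω) with hY
  have hYm : ∀ i, Measurable (Y i) := fun i => (hψ.comp (hX i)).const_mul _
  have hYint : ∫ ω, Y 0 ω ∂μ = 0 := by
    have := (hlaw 0).integral_comp hψ.aestronglyMeasurable
    simp only [hY, integral_const_mul]
    rw [show ∫ ω, projection P Ψ (X 0 ω) ∂μ = _ from this, h0, mul_zero]
  have hYvar : variance (Y 0) μ = ((m : ℝ) + 1) ^ 2 * ∫ s, (projection P Ψ s) ^ 2 ∂P := by
    have := (hlaw 0).integral_comp (f := fun s => (projection P Ψ s) ^ 2)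
      (hψ.pow_const 2).aestronglyMeasurable
    rw [variance_of_integral_eq_zero (hYm 0).aemeasurable hYint, ← this]
    simp only [hY, mul_pow, integral_const_mul, Function.comp_def]
  have hYindep : iIndepFun Y μ :=
    hindep.comp (fun _ s => ((m : ℝ) + 1) * projection P Ψ s) fun _ => hψ.const_mul _
  have hYident : ∀ i, IdentDistrib (Y i) (Y 0) μ μ := fun i =>
    (IdentDistrib.mk (hX i).aemeasurable (hX 0).aemeasurable
      ((hlaw i).map_eq.trans (hlaw 0).map_eq.symm)).comp
      (u := fun s => ((m : ℝ) + 1) * projection P Ψ s) (hψ.const_mul _)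
  have hYmem : MemLp (Y 0) 2 μ :=
    MemLp.of_bound (hYm 0).aestronglyMeasurable (((m : ℝ) + 1) * C)
      (Eventually.of_forall fun ω => by
      rw [hY, Real.norm_eq_abs, abs_mul, abs_of_nonneg (by positivity : (0 : ℝ) ≤ (m : ℝ) + 1)]
      gcongr
      exact abs_projection_le hC _)
  have hclt := tendstoInDistribution_inv_sqrt_mul_sum_sub (P := μ) (X := Y) (Y := id)
    (P' := gaussianReal 0 (variance (Y 0) μ).toNNReal) HasLaw.id hYmem hYindep hYident
  rw! [hYvar] at hclt
  set h := hoeffdingRemainder P Ψ with hh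
  have hhm : Measurable h := measurable_hoeffdingRemainder hΨ
  have hhC : ∀ x, |h x| ≤ (m + 2) * C := abs_hoeffdingRemainder_le hC
  have hdeg := integral_hoeffdingRemainder_insertNth hΨ hC hsymm h0
  have hUm : ∀ n : ℕ, Measurable fun ω => √(n : ℝ) * uStatistic Ψ n fun i => X i ω :=
    fun n => (measurable_uStatistic hΨ hX n).const_mul _
  have hRm : ∀ n : ℕ, Measurable fun ω => √(n : ℝ) * uStatistic h n fun i => X i ω :=
    fun n => (measurable_uStatistic hhm hX n).const_mul _
  refine tendstoInDistribution_of_tendstoInMeasure_sub _ _ hclt ?_ fun n => (hUm n).aemeasurable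
  have hdiff : ∀ n : ℕ, m + 1 ≤ n → ∀ ω, √(n : ℝ) * (uStatistic Ψ n fun i => X i ω) -
      (√(n : ℝ))⁻¹ * (∑ k ∈ Finset.range n, Y k ω - n * ∫ ω, Y 0 ω ∂μ) =
        √(n : ℝ) * uStatistic h n fun i => X i ω := by
    intro n hn ω
    have hn0 : (0 : ℝ) < n := by exact_mod_cast (by omega : 0 < n)
    have hs : √(n : ℝ) ≠ 0 := (Real.sqrt_pos.2 hn0).ne'
    rw [uStatistic_eq_sum_projection_add P Ψ hn, hYint]
    simp only [hY, ← Finset.mul_sum]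
    field_simp
    rw [Real.sq_sqrt hn0.le]
    ring
  -- Convergence in `L²`: the second moment of the `U`-statistic of `h` is `O(n⁻²)`.
  have hR : TendstoInMeasure μ (fun (n : ℕ) ω => √(n : ℝ) * uStatistic h n fun i => X i ω)
      atTop 0 := by
    refine tendstoInMeasure_of_tendsto_eLpNorm (p := 2) (by simp)
      (fun n => (hRm n).aestronglyMeasurable) aestronglyMeasurable_const ?_
    have hnorm : ∀ n : ℕ, eLpNorm ((fun ω => √(n : ℝ) * uStatistic h n fun i => X i ω) - 0) 2 μ =
        ENNReal.ofReal (√(n * ∫ ω, (uStatistic h n fun i => X i ω) ^ 2 ∂μ)) := by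
      intro n
      have hmem : MemLp (fun ω => √(n : ℝ) * uStatistic h n fun i => X i ω) 2 μ :=
        MemLp.of_bound (hRm n).aestronglyMeasurable (√(n : ℝ) * ((m + 2) * C))
          (Eventually.of_forall fun ω => by
            rw [Real.norm_eq_abs, abs_mul, abs_of_nonneg (Real.sqrt_nonneg _)]
            gcongr
            exact abs_uStatistic_le hhC n _)
      rw [sub_zero, hmem.eLpNorm_eq_integral_rpow_norm (by simp) (by simp)]
      simp [mul_pow, integral_const_mul, Real.sqrt_eq_rpow (n * _)]
    simp_rw [hnorm]
    rw [← ENNReal.ofReal_zero, ← Real.sqrt_zero]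
    refine (ENNReal.continuous_ofReal.tendsto _).comp ((Real.continuous_sqrt.tendsto _).comp ?_)
    have hlim : Tendsto (fun n : ℕ => 2 * (((m + 2) * C) ^ 2 * ((m + 1).choose 2 : ℕ) ^ 2) *
        (1 / (((n - 1 : ℕ) : ℝ)))) atTop (nhds 0) := by
      simpa using ((tendsto_one_div_atTop_nhds_zero_nat (𝕜 := ℝ)).comp
        (tendsto_sub_atTop_nat 1)).const_mul
        (2 * (((m + 2) * C) ^ 2 * (((m + 1).choose 2 : ℕ) : ℝ) ^ 2))
    refine squeeze_zero' (Eventually.of_forall fun n => by positivity) ?_ hlim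
    filter_upwards [eventually_ge_atTop (m + 2)] with n hn
    have hle := integral_uStatistic_sq_le hX hlaw hindep hhm hhC hdeg (n := n) (by omega) (by omega)
    have hn1 : (0 : ℝ) < n - 1 := by
      have : (2 : ℝ) ≤ n := by exact_mod_cast (by omega : 2 ≤ n)
      linarith
    have hn0 : (0 : ℝ) < n := by linarith
    calc (n : ℝ) * ∫ ω, (uStatistic h n fun i => X i ω) ^ 2 ∂μ
        ≤ n * (((m + 2) * C) ^ 2 * ((m + 1).choose 2 : ℕ) ^ 2 / (n.choose 2 : ℕ)) := by gcongr
      _ = _ := by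
          rw [Nat.cast_choose_two ℝ n, Nat.cast_sub (by omega : 1 ≤ n), Nat.cast_one]
          field_simp
  refine hR.congr' ?_ Filter.EventuallyEq.rfl
  filter_upwards [eventually_ge_atTop (m + 1)] with n hn
  exact Eventually.of_forall fun ω => (hdiff n hn ω).symm

end UStatistic

/-! ### Conditional expectation given one variable -/

section ConditionalExpectation

variable {m : ℕ} {P : Measure ℝ} [IsProbabilityMeasure P] {Ψ : (Fin (m + 1) → ℝ) → ℝ} {C : ℝ}

/-- For independent variables with a common law, the conditional expectation of a symmetric kernel
given any one of the variables is its projection, evaluated at that variable. -/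
lemma condExp_eq_projection (hΨ : Measurable Ψ) (hC : ∀ x, |Ψ x| ≤ C)
    (hsymm : ∀ (σ : Equiv.Perm (Fin (m + 1))) x, Ψ (x ∘ σ) = Ψ x) (j : Fin (m + 1)) :
    (Measure.pi fun _ : Fin (m + 1) => P)[Ψ |
        MeasurableSpace.comap (fun x : Fin (m + 1) → ℝ => x j) inferInstance]
      =ᵐ[Measure.pi fun _ : Fin (m + 1) => P] fun x => projection P Ψ (x j) := by
  have hψ := measurable_projection (P := P) hΨ
  have hψj : Measurable fun x : Fin (m + 1) → ℝ => projection P Ψ (x j) :=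
    hψ.comp (measurable_pi_apply j)
  have hint1 : Integrable Ψ (Measure.pi fun _ : Fin (m + 1) => P) := Integrable.of_abs_le hΨ hC
  have hint2 : Integrable (fun x : Fin (m + 1) → ℝ => projection P Ψ (x j))
      (Measure.pi fun _ : Fin (m + 1) => P) :=
    Integrable.of_abs_le hψj fun x => abs_projection_le hC _
  have hm : MeasurableSpace.comap (fun x : Fin (m + 1) → ℝ => x j) inferInstance ≤
      (inferInstance : MeasurableSpace (Fin (m + 1) → ℝ)) := (measurable_pi_apply j).comap_le
  refine (ae_eq_condExp_of_forall_setIntegral_eq hm hint1 (fun _ _ _ => hint2.integrableOn) ?_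
    ?_).symm
  · rintro _ ⟨B, hB, rfl⟩ -
    have hBm : MeasurableSet ((fun x : Fin (m + 1) → ℝ => x j) ⁻¹' B) := measurable_pi_apply j hB
    rw [← integral_indicator hBm, ← integral_indicator hBm,
      integral_pi_eq_integral_integral_insertNth j (hint1.indicator hBm),
      integral_pi_eq_integral_integral_insertNth j (hint2.indicator hBm)]
    refine integral_congr_ae (Eventually.of_forall fun s => ?_)
    by_cases hs : s ∈ B
    · simp [Set.indicator, hs, integral_insertNth_eq_projection hsymm]
    · simp [Set.indicator, hs]
  · exact (hψ.comp (comap_measurable _)).aestronglyMeasurable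

end ConditionalExpectation

/-! ### Symmetry, measurability and boundedness of the kernel -/

section Kernel

lemma minExcept_eq {k : ℕ} (x : Fin (k + 1) → ℝ) (j : Fin (k + 1)) :
    minExcept x j = ⨅ i : {i // i ≠ j}, x i :=
  Equiv.iInf_congr (finSuccAboveEquiv j) fun _ => rfl

lemma maxExcept_eq {k : ℕ} (x : Fin (k + 1) → ℝ) (j : Fin (k + 1)) :
    maxExcept x j = ⨆ i : {i // i ≠ j}, x i :=
  Equiv.iSup_congr (finSuccAboveEquiv j) fun _ => rfl

lemma minExcept_comp_perm {k : ℕ} (σ : Equiv.Perm (Fin (k + 1))) (x : Fin (k + 1) → ℝ)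
    (j : Fin (k + 1)) : minExcept (x ∘ σ) j = minExcept x (σ j) := by
  rw [minExcept_eq, minExcept_eq]
  exact Equiv.iInf_congr (σ.subtypeEquiv fun i => by simp) fun _ => rfl

lemma maxExcept_comp_perm {k : ℕ} (σ : Equiv.Perm (Fin (k + 1))) (x : Fin (k + 1) → ℝ)
    (j : Fin (k + 1)) : maxExcept (x ∘ σ) j = maxExcept x (σ j) := by
  rw [maxExcept_eq, maxExcept_eq]
  exact Equiv.iSup_congr (σ.subtypeEquiv fun i => by simp) fun _ => rfl

lemma symmKernel_comp_perm (k : ℕ) (σ : Equiv.Perm (Fin (k + 1))) (x : Fin (k + 1) → ℝ) :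
    symmKernel k (x ∘ σ) = symmKernel k x := by
  simp only [symmKernel, minExcept_comp_perm, maxExcept_comp_perm, Function.comp_apply]
  rw [Equiv.sum_comp σ (fun j => if |minExcept x j| < |x j| then (1 : ℝ) else 0),
    Equiv.sum_comp σ (fun j => if |maxExcept x j| < |x j| then (1 : ℝ) else 0)]

lemma measurable_minExcept {k : ℕ} (j : Fin (k + 1)) :
    Measurable fun x : Fin (k + 1) → ℝ => minExcept x j :=
  Measurable.iInf fun _ => measurable_pi_apply _

lemma measurable_maxExcept {k : ℕ} (j : Fin (k + 1)) :
    Measurable fun x : Fin (k + 1) → ℝ => maxExcept x j :=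
  Measurable.iSup fun _ => measurable_pi_apply _

open Classical in
lemma measurable_ite_abs_minExcept_lt {k : ℕ} (j : Fin (k + 1)) :
    Measurable fun x : Fin (k + 1) → ℝ => if |minExcept x j| < |x j| then (1 : ℝ) else 0 :=
  Measurable.ite (measurableSet_lt (measurable_minExcept j).abs (measurable_pi_apply j).abs)
    measurable_const measurable_const

open Classical in
lemma measurable_ite_abs_maxExcept_lt {k : ℕ} (j : Fin (k + 1)) :
    Measurable fun x : Fin (k + 1) → ℝ => if |maxExcept x j| < |x j| then (1 : ℝ) else 0 :=
  Measurable.ite (measurableSet_lt (measurable_maxExcept j).abs (measurable_pi_apply j).abs)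
    measurable_const measurable_const

lemma measurable_symmKernel (k : ℕ) : Measurable (symmKernel k) :=
  ((Finset.measurable_sum _ fun j _ => measurable_ite_abs_minExcept_lt j).sub
    (Finset.measurable_sum _ fun j _ => measurable_ite_abs_maxExcept_lt j)).const_mul _

lemma abs_symmKernel_le (k : ℕ) (x : Fin (k + 1) → ℝ) : |symmKernel k x| ≤ 1 := by
  classical
  have hk : (0 : ℝ) < (k : ℝ) + 1 := by positivity
  rw [symmKernel, abs_mul, abs_inv, abs_of_pos hk, inv_mul_le_iff₀ hk, mul_one,
    ← Finset.sum_sub_distrib]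
  refine (Finset.abs_sum_le_sum_abs _ _).trans ?_
  have : ∀ j ∈ (Finset.univ : Finset (Fin (k + 1))),
      |(if |minExcept x j| < |x j| then (1 : ℝ) else 0) -
        if |maxExcept x j| < |x j| then (1 : ℝ) else 0| ≤ 1 := fun j _ => by
    split_ifs <;> simp
  simpa using Finset.sum_le_card_nsmul _ _ _ this

end Kernel

/-! ### Laws of the extremes of independent variables -/

section Extremes

variable {n : ℕ}

open Classical in
/-- The maximum has absolute value below `t` when all entries are below `t`, but not all are at most
`-t`. Both conditions are products over the entries. -/
lemma ite_abs_iSup_lt_eq [NeZero n] (y : Fin n → ℝ) {t : ℝ} (ht : 0 < t) :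
    (if |⨆ i, y i| < t then (1 : ℝ) else 0) =
      (∏ i, if y i < t then (1 : ℝ) else 0) - ∏ i, if y i ≤ -t then (1 : ℝ) else 0 := by
  have h1 : ⨆ i, y i < t ↔ ∀ i, y i < t := by
    refine ⟨fun h i => (le_ciSup (Set.finite_range y).bddAbove i).trans_lt h, fun h => ?_⟩
    obtain ⟨i, hi⟩ := exists_eq_ciSup_of_finite (f := y)
    exact hi ▸ h i
  have h2 : ⨆ i, y i ≤ -t ↔ ∀ i, y i ≤ -t := ciSup_le_iff (Set.finite_range y).bddAbove
  simp only [Finset.prod_ite_zero, Finset.prod_const_one, Finset.mem_univ, true_imp_iff, ← h1,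
    ← h2, abs_lt]
  split_ifs <;> grind

open Classical in
lemma ite_abs_iInf_lt_eq [NeZero n] (y : Fin n → ℝ) {t : ℝ} (ht : 0 < t) :
    (if |⨅ i, y i| < t then (1 : ℝ) else 0) =
      (∏ i, if -t < y i then (1 : ℝ) else 0) - ∏ i, if t ≤ y i then (1 : ℝ) else 0 := by
  have h1 : -t < ⨅ i, y i ↔ ∀ i, -t < y i := by
    refine ⟨fun h i => h.trans_le (ciInf_le (Set.finite_range y).bddBelow i), fun h => ?_⟩
    obtain ⟨i, hi⟩ := exists_eq_ciInf_of_finite (f := y)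
    exact hi ▸ h i
  have h2 : t ≤ ⨅ i, y i ↔ ∀ i, t ≤ y i := le_ciInf_iff (Set.finite_range y).bddBelow
  simp only [Finset.prod_ite_zero, Finset.prod_const_one, Finset.mem_univ, true_imp_iff, ← h1,
    ← h2, abs_lt]
  split_ifs <;> grind

variable {P : Measure ℝ} [IsProbabilityMeasure P]

open Classical in
lemma integral_prod_ite_mem {A : Set ℝ} (hA : MeasurableSet A) :
    ∫ y : Fin n → ℝ, ∏ i, (if y i ∈ A then (1 : ℝ) else 0) ∂(Measure.pi fun _ : Fin n => P) =
      P.real A ^ n := by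
  rw [integral_fintype_prod_eq_prod (μ := fun _ : Fin n => P)
    (f := fun _ (z : ℝ) => if z ∈ A then (1 : ℝ) else 0)]
  have : ∫ z, (if z ∈ A then (1 : ℝ) else 0) ∂P = P.real A := integral_indicator_one hA
  simp [this]

open Classical in
lemma integrable_prod_ite_mem {A : Set ℝ} (hA : MeasurableSet A) :
    Integrable (fun y : Fin n → ℝ => ∏ i, (if y i ∈ A then (1 : ℝ) else 0))
      (Measure.pi fun _ : Fin n => P) :=
  Integrable.fintype_prod (μ := fun _ : Fin n => P)
    (f := fun _ (z : ℝ) => if z ∈ A then (1 : ℝ) else 0)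
    fun _ => (integrable_const (1 : ℝ)).indicator hA

open Classical in
lemma integral_ite_abs_iSup_lt [NeZero n] {t : ℝ} (ht : 0 < t) :
    ∫ y : Fin n → ℝ, (if |⨆ i, y i| < t then (1 : ℝ) else 0) ∂(Measure.pi fun _ : Fin n => P) =
      P.real (Set.Iio t) ^ n - P.real (Set.Iic (-t)) ^ n := by
  simp_rw [fun y : Fin n → ℝ => ite_abs_iSup_lt_eq y ht]
  rw [← integral_prod_ite_mem measurableSet_Iio, ← integral_prod_ite_mem measurableSet_Iic]
  exact integral_sub (integrable_prod_ite_mem measurableSet_Iio)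
    (integrable_prod_ite_mem measurableSet_Iic)

open Classical in
lemma integral_ite_abs_iInf_lt [NeZero n] {t : ℝ} (ht : 0 < t) :
    ∫ y : Fin n → ℝ, (if |⨅ i, y i| < t then (1 : ℝ) else 0) ∂(Measure.pi fun _ : Fin n => P) =
      P.real (Set.Ioi (-t)) ^ n - P.real (Set.Ici t) ^ n := by
  simp_rw [fun y : Fin n → ℝ => ite_abs_iInf_lt_eq y ht]
  rw [← integral_prod_ite_mem measurableSet_Ioi, ← integral_prod_ite_mem measurableSet_Ici]
  exact integral_sub (integrable_prod_ite_mem measurableSet_Ioi)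
    (integrable_prod_ite_mem measurableSet_Ici)

open Classical in
lemma integral_ite_abs_iSup_cons_lt (s : ℝ) {t : ℝ} (ht : 0 < t) :
    ∫ w : Fin n → ℝ, (if |⨆ i, (Fin.cons s w : Fin (n + 1) → ℝ) i| < t then (1 : ℝ) else 0)
        ∂(Measure.pi fun _ : Fin n => P) =
      (if s < t then 1 else 0) * P.real (Set.Iio t) ^ n -
        (if s ≤ -t then 1 else 0) * P.real (Set.Iic (-t)) ^ n := by
  simp_rw [fun y : Fin (n + 1) → ℝ => ite_abs_iSup_lt_eq y ht, Fin.prod_univ_succ, Fin.cons_zero,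
    Fin.cons_succ]
  rw [← integral_prod_ite_mem measurableSet_Iio, ← integral_prod_ite_mem measurableSet_Iic,
    ← integral_const_mul, ← integral_const_mul]
  exact integral_sub ((integrable_prod_ite_mem measurableSet_Iio).const_mul _)
    ((integrable_prod_ite_mem measurableSet_Iic).const_mul _)

open Classical in
lemma integral_ite_abs_iInf_cons_lt (s : ℝ) {t : ℝ} (ht : 0 < t) :
    ∫ w : Fin n → ℝ, (if |⨅ i, (Fin.cons s w : Fin (n + 1) → ℝ) i| < t then (1 : ℝ) else 0)
        ∂(Measure.pi fun _ : Fin n => P) =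
      (if -t < s then 1 else 0) * P.real (Set.Ioi (-t)) ^ n -
        (if t ≤ s then 1 else 0) * P.real (Set.Ici t) ^ n := by
  simp_rw [fun y : Fin (n + 1) → ℝ => ite_abs_iInf_lt_eq y ht, Fin.prod_univ_succ, Fin.cons_zero,
    Fin.cons_succ]
  rw [← integral_prod_ite_mem measurableSet_Ioi, ← integral_prod_ite_mem measurableSet_Ici,
    ← integral_const_mul, ← integral_const_mul]
  exact integral_sub ((integrable_prod_ite_mem measurableSet_Ioi).const_mul _)
    ((integrable_prod_ite_mem measurableSet_Ici).const_mul _)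

end Extremes

/-! ### The uniform distribution on `[-1, 1]` -/

section SymmUniform

lemma symmUniform_apply (A : Set ℝ) :
    symmUniform A = 2⁻¹ * volume (Set.Icc (-1) 1 ∩ A) := by
  rw [symmUniform, cond_apply measurableSet_Icc, Real.volume_Icc]
  norm_num

lemma symmUniform_eq_smul :
    symmUniform = (2⁻¹ : ENNReal) • volume.restrict (Set.Icc (-1 : ℝ) 1) := by
  rw [symmUniform, ProbabilityTheory.cond, Real.volume_Icc]
  norm_num

instance : NullSingletonClass symmUniform := by
  rw [symmUniform_eq_smul]
  exact ⟨fun x => by simp⟩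

lemma ae_symmUniform_mem_Icc : ∀ᵐ s ∂symmUniform, s ∈ Set.Icc (-1 : ℝ) 1 := by
  rw [symmUniform_eq_smul]
  exact Measure.ae_smul_measure (ae_restrict_mem measurableSet_Icc) _

lemma ae_symmUniform_ne (a : ℝ) : ∀ᵐ s ∂symmUniform, s ≠ a := by
  simp [ae_iff]

lemma symmUniform_real_Iic {t : ℝ} (ht : t ∈ Set.Icc (-1 : ℝ) 1) :
    symmUniform.real (Set.Iic t) = (1 + t) / 2 := by
  have h : Set.Icc (-1 : ℝ) 1 ∩ Set.Iic t = Set.Icc (-1) t := by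
    ext x
    simp only [Set.mem_inter_iff, Set.mem_Icc, Set.mem_Iic]
    exact ⟨fun h => ⟨h.1.1, h.2⟩, fun h => ⟨⟨h.1, h.2.trans ht.2⟩, h.2⟩⟩
  rw [measureReal_def, symmUniform_apply, h, Real.volume_Icc, ENNReal.toReal_mul,
    ENNReal.toReal_ofReal (by linarith [ht.1])]
  simp
  ring

lemma symmUniform_real_Iio {t : ℝ} (ht : t ∈ Set.Icc (-1 : ℝ) 1) :
    symmUniform.real (Set.Iio t) = (1 + t) / 2 := by
  rw [← symmUniform_real_Iic ht]
  exact measureReal_congr Iio_ae_eq_Iic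

lemma symmUniform_real_Ioi {t : ℝ} (ht : t ∈ Set.Icc (-1 : ℝ) 1) :
    symmUniform.real (Set.Ioi t) = (1 - t) / 2 := by
  rw [← Set.compl_Iic, probReal_compl_eq_one_sub measurableSet_Iic, symmUniform_real_Iic ht]
  ring

lemma symmUniform_real_Ici {t : ℝ} (ht : t ∈ Set.Icc (-1 : ℝ) 1) :
    symmUniform.real (Set.Ici t) = (1 - t) / 2 := by
  rw [← symmUniform_real_Ioi ht]
  exact measureReal_congr Ioi_ae_eq_Ici.symm

lemma integral_symmUniform (f : ℝ → ℝ) :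
    ∫ s, f s ∂symmUniform = 2⁻¹ * ∫ s in (-1 : ℝ)..1, f s := by
  rw [symmUniform_eq_smul, integral_smul_measure, integral_Icc_eq_integral_Ioc,
    intervalIntegral.integral_of_le (by norm_num)]
  simp

/-- The absolute value of a variable that is uniform on `[-1, 1]` is uniform on `[0, 1]`. -/
lemma integral_symmUniform_comp_abs (f : ℝ → ℝ) :
    ∫ s, f |s| ∂symmUniform = ∫ s in (0 : ℝ)..1, f s := by
  have h1 : ∀ s : ℝ, (Set.Icc (-1 : ℝ) 1).indicator (fun s => f |s|) s =
      (Set.Iic (1 : ℝ)).indicator f |s| := by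
    intro s
    simp [Set.indicator, abs_le]
  rw [symmUniform_eq_smul, integral_smul_measure, ← integral_indicator measurableSet_Icc]
  simp_rw [h1]
  rw [integral_comp_abs, integral_indicator measurableSet_Iic,
    Measure.restrict_restrict measurableSet_Iic, intervalIntegral.integral_of_le zero_le_one,
    Set.inter_comm, Set.Ioi_inter_Iic]
  simp

lemma integral_symmUniform_comp_neg (f : ℝ → ℝ) :
    ∫ s, f (-s) ∂symmUniform = ∫ s, f s ∂symmUniform := by
  rw [integral_symmUniform, integral_symmUniform, intervalIntegral.integral_comp_neg]
  simp

end SymmUniform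

/-! ### The projection as an integral -/

section ProjectionFormula

variable {m : ℕ}

lemma minExcept_cons_zero (s : ℝ) (y : Fin (m + 1) → ℝ) :
    minExcept (Fin.cons s y : Fin (m + 2) → ℝ) 0 = ⨅ i, y i := by
  simp [minExcept]

lemma maxExcept_cons_zero (s : ℝ) (y : Fin (m + 1) → ℝ) :
    maxExcept (Fin.cons s y : Fin (m + 2) → ℝ) 0 = ⨆ i, y i := by
  simp [maxExcept]

lemma cons_insertNth_succ_succAbove (s z : ℝ) (w : Fin m → ℝ) (i q : Fin (m + 1)) :
    (Fin.cons s (i.insertNth z w : Fin (m + 1) → ℝ) : Fin (m + 2) → ℝ) (i.succ.succAbove q) =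
      (Fin.cons s w : Fin (m + 1) → ℝ) q := by
  refine Fin.cases ?_ (fun q => ?_) q
  · simp
  · simp [Fin.succ_succAbove_succ]

lemma minExcept_cons_insertNth_succ (s z : ℝ) (w : Fin m → ℝ) (i : Fin (m + 1)) :
    minExcept (Fin.cons s (i.insertNth z w : Fin (m + 1) → ℝ) : Fin (m + 2) → ℝ) i.succ =
      ⨅ q, (Fin.cons s w : Fin (m + 1) → ℝ) q := by
  simp_rw [minExcept, cons_insertNth_succ_succAbove]

lemma maxExcept_cons_insertNth_succ (s z : ℝ) (w : Fin m → ℝ) (i : Fin (m + 1)) :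
    maxExcept (Fin.cons s (i.insertNth z w : Fin (m + 1) → ℝ) : Fin (m + 2) → ℝ) i.succ =
      ⨆ q, (Fin.cons s w : Fin (m + 1) → ℝ) q := by
  simp_rw [maxExcept, cons_insertNth_succ_succAbove]

open Classical in
/-- The summand of the kernel in which the fixed variable plays the role of `x_j` averages to
zero, since the minimum and the maximum of the other variables are equal in law up to sign. -/
lemma integral_symmKernel_summand_zero (s : ℝ) (hs : s ∈ Set.Icc (-1 : ℝ) 1) :
    (∫ y : Fin (m + 1) → ℝ, (if |minExcept (Fin.cons s y : Fin (m + 2) → ℝ) 0| <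
        |(Fin.cons s y : Fin (m + 2) → ℝ) 0| then (1 : ℝ) else 0)
        ∂(Measure.pi fun _ : Fin (m + 1) => symmUniform)) =
      ∫ y : Fin (m + 1) → ℝ, (if |maxExcept (Fin.cons s y : Fin (m + 2) → ℝ) 0| <
        |(Fin.cons s y : Fin (m + 2) → ℝ) 0| then (1 : ℝ) else 0)
        ∂(Measure.pi fun _ : Fin (m + 1) => symmUniform) := by
  simp_rw [minExcept_cons_zero, maxExcept_cons_zero, Fin.cons_zero]
  rcases eq_or_ne s 0 with rfl | h0
  · have h : ∀ a : ℝ, ¬ |a| < 0 := fun a => (abs_nonneg a).not_gt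
    simp [h]
  · have ht : |s| ∈ Set.Icc (-1 : ℝ) 1 := ⟨by linarith [abs_nonneg s], abs_le.2 hs⟩
    have ht' : -|s| ∈ Set.Icc (-1 : ℝ) 1 := ⟨by linarith [ht.2], by linarith [ht.1]⟩
    rw [integral_ite_abs_iSup_lt (abs_pos.2 h0), integral_ite_abs_iInf_lt (abs_pos.2 h0),
      symmUniform_real_Iio ht, symmUniform_real_Ici ht, symmUniform_real_Iic ht',
      symmUniform_real_Ioi ht']
    ring

open Classical in
/-- Given the value `z` of the variable in the role of `x_j`, the two indicators of such a summand
differ only if `|z| ≤ |s|`, and then the sign of the difference is that of `s`. -/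
lemma integral_symmKernel_summand_succ (s : ℝ) (i : Fin (m + 1)) :
    (∫ y : Fin (m + 1) → ℝ, (if |minExcept (Fin.cons s y : Fin (m + 2) → ℝ) i.succ| <
        |(Fin.cons s y : Fin (m + 2) → ℝ) i.succ| then (1 : ℝ) else 0)
        ∂(Measure.pi fun _ : Fin (m + 1) => symmUniform)) -
      ∫ y : Fin (m + 1) → ℝ, (if |maxExcept (Fin.cons s y : Fin (m + 2) → ℝ) i.succ| <
        |(Fin.cons s y : Fin (m + 2) → ℝ) i.succ| then (1 : ℝ) else 0)
        ∂(Measure.pi fun _ : Fin (m + 1) => symmUniform) =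
      ∫ t in (0 : ℝ)..1, ((if t ≤ s then 1 else 0) - if s ≤ -t then 1 else 0) *
        (((1 + t) / 2) ^ m - ((1 - t) / 2) ^ m) := by
  have hcons : Measurable fun y : Fin (m + 1) → ℝ => (Fin.cons s y : Fin (m + 2) → ℝ) :=
    measurable_cons.comp measurable_prodMk_left
  have hmin : Integrable (fun y : Fin (m + 1) → ℝ =>
      if |minExcept (Fin.cons s y : Fin (m + 2) → ℝ) i.succ| <
        |(Fin.cons s y : Fin (m + 2) → ℝ) i.succ| then (1 : ℝ) else 0)
      (Measure.pi fun _ : Fin (m + 1) => symmUniform) :=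
    Integrable.of_abs_le ((measurable_ite_abs_minExcept_lt i.succ).comp hcons) (C := 1)
      fun y => by split_ifs <;> simp
  have hmax : Integrable (fun y : Fin (m + 1) → ℝ =>
      if |maxExcept (Fin.cons s y : Fin (m + 2) → ℝ) i.succ| <
        |(Fin.cons s y : Fin (m + 2) → ℝ) i.succ| then (1 : ℝ) else 0)
      (Measure.pi fun _ : Fin (m + 1) => symmUniform) :=
    Integrable.of_abs_le ((measurable_ite_abs_maxExcept_lt i.succ).comp hcons) (C := 1)
      fun y => by split_ifs <;> simp
  rw [← integral_sub hmin hmax, integral_pi_eq_integral_integral_insertNth i,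
    ← integral_symmUniform_comp_abs]
  swap
  · exact hmin.sub hmax
  refine integral_congr_ae ?_
  filter_upwards [ae_symmUniform_mem_Icc, ae_symmUniform_ne 0] with z hz hz0
  have ht : |z| ∈ Set.Icc (-1 : ℝ) 1 := ⟨by linarith [abs_nonneg z], abs_le.2 hz⟩
  have ht' : -|z| ∈ Set.Icc (-1 : ℝ) 1 := ⟨by linarith [ht.2], by linarith [ht.1]⟩
  have hpos : 0 < |z| := abs_pos.2 hz0
  have hins : Measurable fun w : Fin m → ℝ => (i.insertNth z w : Fin (m + 1) → ℝ) :=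
    (measurable_insertNth i).comp measurable_prodMk_left
  have hmin' := Integrable.of_abs_le (μ := Measure.pi fun _ : Fin m => symmUniform)
    ((measurable_ite_abs_minExcept_lt i.succ).comp (hcons.comp hins)) (C := 1)
    fun w => by simp only [Function.comp_apply]; split_ifs <;> simp
  have hmax' := Integrable.of_abs_le (μ := Measure.pi fun _ : Fin m => symmUniform)
    ((measurable_ite_abs_maxExcept_lt i.succ).comp (hcons.comp hins)) (C := 1)
    fun w => by simp only [Function.comp_apply]; split_ifs <;> simp
  simp only [Function.comp_def] at hmin' hmax'
  rw [integral_sub hmin' hmax']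
  simp only [minExcept_cons_insertNth_succ, maxExcept_cons_insertNth_succ, Fin.cons_succ,
    Fin.insertNth_apply_same]
  rw [integral_ite_abs_iSup_cons_lt s hpos, integral_ite_abs_iInf_cons_lt s hpos,
    symmUniform_real_Iio ht, symmUniform_real_Ici ht, symmUniform_real_Iic ht',
    symmUniform_real_Ioi ht', sub_neg_eq_add, ← sub_eq_add_neg]
  have e1 : (if -|z| < s then (1 : ℝ) else 0) = 1 - if s ≤ -|z| then 1 else 0 := by
    split_ifs <;> linarith
  have e2 : (if s < |z| then (1 : ℝ) else 0) = 1 - if |z| ≤ s then 1 else 0 := by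
    split_ifs <;> linarith
  rw [e1, e2]
  ring

open Classical in
lemma projection_symmUniform_eq_integral {s : ℝ} (hs : s ∈ Set.Icc (-1 : ℝ) 1) :
    projection symmUniform (symmKernel (m + 1)) s =
      ((m : ℝ) + 1) / (m + 2) *
        ∫ t in (0 : ℝ)..1, ((if t ≤ s then 1 else 0) - if s ≤ -t then 1 else 0) *
          (((1 + t) / 2) ^ m - ((1 - t) / 2) ^ m) := by
  have hcons : Measurable fun y : Fin (m + 1) → ℝ => (Fin.cons s y : Fin (m + 2) → ℝ) :=
    measurable_cons.comp measurable_prodMk_left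
  have hmin : ∀ j ∈ Finset.univ, Integrable (fun y : Fin (m + 1) → ℝ =>
      if |minExcept (Fin.cons s y : Fin (m + 2) → ℝ) j| <
        |(Fin.cons s y : Fin (m + 2) → ℝ) j| then (1 : ℝ) else 0)
      (Measure.pi fun _ : Fin (m + 1) => symmUniform) := fun j _ =>
    Integrable.of_abs_le ((measurable_ite_abs_minExcept_lt j).comp hcons) (C := 1)
      fun y => by split_ifs <;> simp
  have hmax : ∀ j ∈ Finset.univ, Integrable (fun y : Fin (m + 1) → ℝ =>
      if |maxExcept (Fin.cons s y : Fin (m + 2) → ℝ) j| <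
        |(Fin.cons s y : Fin (m + 2) → ℝ) j| then (1 : ℝ) else 0)
      (Measure.pi fun _ : Fin (m + 1) => symmUniform) := fun j _ =>
    Integrable.of_abs_le ((measurable_ite_abs_maxExcept_lt j).comp hcons) (C := 1)
      fun y => by split_ifs <;> simp
  simp only [projection, symmKernel]
  rw [integral_const_mul,
    integral_sub (integrable_finsetSum _ hmin) (integrable_finsetSum _ hmax),
    integral_finsetSum _ hmin, integral_finsetSum _ hmax, ← Finset.sum_sub_distrib,
    Fin.sum_univ_succ, integral_symmKernel_summand_zero s hs, sub_self, zero_add,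
    Finset.sum_congr rfl fun i _ => integral_symmKernel_summand_succ s i]
  rw [Finset.sum_const, Finset.card_fin, nsmul_eq_mul]
  push_cast
  field_simp
  ring_nf

lemma integral_pow_sub_pow (s : ℝ) :
    ∫ t in (0 : ℝ)..s, (((1 + t) / 2) ^ m - ((1 - t) / 2) ^ m) =
      ((1 + s) ^ (m + 1) + (1 - s) ^ (m + 1) - 2) / ((m + 1) * 2 ^ m) := by
  have hd : ∀ t ∈ Set.uIcc 0 s, HasDerivAt
      (fun t : ℝ => ((1 + t) ^ (m + 1) + (1 - t) ^ (m + 1) - 2) / ((m + 1) * 2 ^ m))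
      (((1 + t) / 2) ^ m - ((1 - t) / 2) ^ m) t := by
    intro t _
    have h1 := ((hasDerivAt_id t).const_add 1).pow (m + 1)
    have h2 := ((hasDerivAt_id t).const_sub 1).pow (m + 1)
    have h := ((h1.add h2).sub_const 2).div_const (((m : ℝ) + 1) * 2 ^ m)
    refine h.congr_deriv ?_
    simp only [id, Nat.add_sub_cancel, div_pow]
    push_cast
    field_simp
    ring
  rw [intervalIntegral.integral_eq_sub_of_hasDerivAt hd
    (Continuous.intervalIntegrable (by fun_prop) _ _)]
  norm_num

end ProjectionFormula

/-! ### The projection in closed form and its variance -/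

section ProjectionSymmUniform

variable {k : ℕ}

lemma projection_symmUniform_eq (hk : 1 ≤ k) {s : ℝ} (hs : s ∈ Set.Icc (-1 : ℝ) 1) :
    projection symmUniform (symmKernel k) s =
      if 0 < s then ((1 + s) ^ k + (1 - s) ^ k - 2) / (((k : ℝ) + 1) * 2 ^ (k - 1))
      else -(((1 + s) ^ k + (1 - s) ^ k - 2) / (((k : ℝ) + 1) * 2 ^ (k - 1))) := by
  classical
  obtain ⟨m, rfl⟩ : ∃ m, k = m + 1 := ⟨k - 1, by omega⟩
  rw [projection_symmUniform_eq_integral hs]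
  set g : ℝ → ℝ := fun t => ((1 + t) / 2) ^ m - ((1 - t) / 2) ^ m with hg
  have hgc : Continuous g := by fun_prop
  have htrunc : ∀ a : ℝ, 0 ≤ a → a ≤ 1 →
      ∫ t in (0 : ℝ)..1, (if t ≤ a then (1 : ℝ) else 0) * g t = ∫ t in (0 : ℝ)..a, g t := by
    intro a ha0 ha1
    rw [intervalIntegral.integral_of_le zero_le_one, intervalIntegral.integral_of_le ha0]
    have : ∀ t, (if t ≤ a then (1 : ℝ) else 0) * g t = (Set.Iic a).indicator g t := fun t => by
      simp [Set.indicator_apply]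
    simp_rw [this]
    rw [integral_indicator measurableSet_Iic, Measure.restrict_restrict measurableSet_Iic,
      Set.inter_comm, Set.Ioc_inter_Iic, min_eq_right ha1]
  have hcast : ((m + 1 : ℕ) : ℝ) = m + 1 := by push_cast; ring
  rw [Nat.add_sub_cancel, hcast]
  -- In the second case the first indicator vanishes only almost everywhere: it is one at
  -- `s = t = 0`.
  split_ifs with h0
  · have hI : ∫ t in (0 : ℝ)..1, ((if t ≤ s then 1 else 0) - if s ≤ -t then 1 else 0) * g t =
        ∫ t in (0 : ℝ)..s, g t := by
      rw [← htrunc s h0.le hs.2]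
      refine intervalIntegral.integral_congr fun t ht => ?_
      rw [Set.uIcc_of_le zero_le_one] at ht
      have : ¬ s ≤ -t := by linarith [ht.1]
      simp [this]
    rw [hI, integral_pow_sub_pow]
    field_simp
    ring
  · have hs0 : 0 ≤ -s := by linarith
    have hI : ∫ t in (0 : ℝ)..1, ((if t ≤ s then 1 else 0) - if s ≤ -t then 1 else 0) * g t =
        -∫ t in (0 : ℝ)..(-s), g t := by
      rw [← htrunc (-s) hs0 (by linarith [hs.1]), ← intervalIntegral.integral_neg,
        intervalIntegral.integral_of_le zero_le_one, intervalIntegral.integral_of_le zero_le_one]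
      refine setIntegral_congr_fun measurableSet_Ioc fun t ht => ?_
      have h1 : ¬ t ≤ s := by linarith [ht.1]
      have h2 : s ≤ -t ↔ t ≤ -s := le_neg
      simp [h1, h2]
    rw [hI, integral_pow_sub_pow]
    field_simp
    ring

lemma projection_symmUniform_neg (hk : 1 ≤ k) {s : ℝ} (hs : s ∈ Set.Icc (-1 : ℝ) 1) (hs0 : s ≠ 0) :
    projection symmUniform (symmKernel k) (-s) = -projection symmUniform (symmKernel k) s := by
  rw [projection_symmUniform_eq hk hs,
    projection_symmUniform_eq hk ⟨by linarith [hs.2], by linarith [hs.1]⟩]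
  rcases hs0.lt_or_gt with h | h
  · rw [if_pos (by linarith), if_neg (by linarith)]
    ring
  · rw [if_neg (by linarith), if_pos h]
    ring

lemma integral_projection_symmUniform (hk : 1 ≤ k) :
    ∫ s, projection symmUniform (symmKernel k) s ∂symmUniform = 0 := by
  have h : ∫ s, projection symmUniform (symmKernel k) (-s) ∂symmUniform =
      -∫ s, projection symmUniform (symmKernel k) s ∂symmUniform := by
    rw [← integral_neg]
    refine integral_congr_ae ?_
    filter_upwards [ae_symmUniform_mem_Icc, ae_symmUniform_ne 0] with s hs hs0
    exact projection_symmUniform_neg hk hs hs0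
  rw [integral_symmUniform_comp_neg fun s => projection symmUniform (symmKernel k) s] at h
  linarith

lemma variance_projection_symmUniform (hk : 1 ≤ k) :
    variance (projection symmUniform (symmKernel k)) symmUniform = sigmaSq k :=
  variance_of_integral_eq_zero (measurable_projection (measurable_symmKernel k)).aemeasurable
    (integral_projection_symmUniform hk)

lemma sigmaSq_eq (hk : 1 ≤ k) :
    sigmaSq k = (2 ^ (2 * k - 2) * ((k : ℝ) + 1) ^ 2)⁻¹ *
      ∫ s in (0 : ℝ)..1, ((1 + s) ^ k + (1 - s) ^ k - 2) ^ 2 := by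
  rw [← intervalIntegral.integral_const_mul, ← integral_symmUniform_comp_abs, sigmaSq]
  refine integral_congr_ae ?_
  filter_upwards [ae_symmUniform_mem_Icc] with s hs
  have hp : (2 : ℝ) ^ (2 * k - 2) = (2 ^ (k - 1)) ^ 2 := by
    rw [← pow_mul]
    congr 1
    omega
  have hsq : ∀ a : ℝ, (a / (((k : ℝ) + 1) * 2 ^ (k - 1))) ^ 2 =
      (2 ^ (2 * k - 2) * ((k : ℝ) + 1) ^ 2)⁻¹ * a ^ 2 := by
    intro a
    rw [hp]
    field_simp
  simp only [projection_symmUniform_eq hk hs]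
  rcases le_or_gt 0 s with h | h
  · rw [abs_of_nonneg h, ← hsq]
    split_ifs <;> ring
  · rw [abs_of_neg h, ← hsq, if_neg h.not_gt]
    ring

lemma sigmaSq_pos (hk : 2 ≤ k) : 0 < sigmaSq k := by
  rw [sigmaSq_eq (by omega)]
  refine mul_pos (by positivity) ?_
  have hne : (2 : ℝ) ^ k - 2 ≠ 0 := by
    have : (2 : ℝ) ^ 2 ≤ 2 ^ k := pow_le_pow_right₀ one_le_two hk
    linarith
  refine intervalIntegral.integral_pos zero_lt_one (by fun_prop) (fun s _ => sq_nonneg _)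
    ⟨1, by simp, ?_⟩
  have h : ((1 + 1 : ℝ) ^ k + (1 - 1) ^ k - 2) = 2 ^ k - 2 := by
    rw [sub_self, zero_pow (by omega)]
    norm_num
  rw [h]
  positivity

lemma sigmaSq_two : sigmaSq 2 = 1 / 45 := by
  rw [sigmaSq_eq (by norm_num)]
  have : ∀ s : ℝ, ((1 + s) ^ 2 + (1 - s) ^ 2 - 2) ^ 2 = 4 * s ^ 4 := fun s => by ring
  simp_rw [this]
  simp only [intervalIntegral.integral_const_mul, integral_pow]
  norm_num

lemma sigmaSq_three : sigmaSq 3 = 9 / 320 := by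
  rw [sigmaSq_eq (by norm_num)]
  have : ∀ s : ℝ, ((1 + s) ^ 3 + (1 - s) ^ 3 - 2) ^ 2 = 36 * s ^ 4 := fun s => by ring
  simp_rw [this]
  simp only [intervalIntegral.integral_const_mul, integral_pow]
  norm_num

lemma sigmaSq_four : sigmaSq 4 = 2843 / 126000 := by
  rw [sigmaSq_eq (by norm_num)]
  have : ∀ s : ℝ, ((1 + s) ^ 4 + (1 - s) ^ 4 - 2) ^ 2 = 144 * s ^ 4 + 48 * s ^ 6 + 4 * s ^ 8 :=
    fun s => by ring
  simp_rw [this]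
  have hi : ∀ (c : ℝ) (n : ℕ), IntervalIntegrable (fun s : ℝ => c * s ^ n) volume 0 1 :=
    fun c n => Continuous.intervalIntegrable (by fun_prop) _ _
  rw [intervalIntegral.integral_add ((hi _ _).add (hi _ _)) (hi _ _),
    intervalIntegral.integral_add (hi _ _) (hi _ _)]
  simp only [intervalIntegral.integral_const_mul, integral_pow]
  norm_num

lemma sigmaSq_five : sigmaSq 5 = 2335 / 145152 := by
  rw [sigmaSq_eq (by norm_num)]
  have : ∀ s : ℝ, ((1 + s) ^ 5 + (1 - s) ^ 5 - 2) ^ 2 =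
      400 * s ^ 4 + 400 * s ^ 6 + 100 * s ^ 8 := fun s => by ring
  simp_rw [this]
  have hi : ∀ (c : ℝ) (n : ℕ), IntervalIntegrable (fun s : ℝ => c * s ^ n) volume 0 1 :=
    fun c n => Continuous.intervalIntegrable (by fun_prop) _ _
  rw [intervalIntegral.integral_add ((hi _ _).add (hi _ _)) (hi _ _),
    intervalIntegral.integral_add (hi _ _) (hi _ _)]
  simp only [intervalIntegral.integral_const_mul, integral_pow]
  norm_num

lemma sigmaSq_six : sigmaSq 6 = 421691 / 37669632 := by
  rw [sigmaSq_eq (by norm_num)]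
  have : ∀ s : ℝ, ((1 + s) ^ 6 + (1 - s) ^ 6 - 2) ^ 2 =
      900 * s ^ 4 + 1800 * s ^ 6 + 1020 * s ^ 8 + 120 * s ^ 10 + 4 * s ^ 12 := fun s => by ring
  simp_rw [this]
  have hi : ∀ (c : ℝ) (n : ℕ), IntervalIntegrable (fun s : ℝ => c * s ^ n) volume 0 1 :=
    fun c n => Continuous.intervalIntegrable (by fun_prop) _ _
  rw [intervalIntegral.integral_add ((((hi _ _).add (hi _ _)).add (hi _ _)).add (hi _ _)) (hi _ _),
    intervalIntegral.integral_add (((hi _ _).add (hi _ _)).add (hi _ _)) (hi _ _),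
    intervalIntegral.integral_add ((hi _ _).add (hi _ _)) (hi _ _),
    intervalIntegral.integral_add (hi _ _) (hi _ _)]
  simp only [intervalIntegral.integral_const_mul, integral_pow]
  norm_num

end ProjectionSymmUniform

/-! ### The probability integral transform -/

section ProbabilityIntegralTransform

variable {P : Measure ℝ}

/-- Under the symmetry hypothesis the distribution function is continuous: left continuity at `x`
is right continuity at `-x`. -/
lemma SymmetryHypothesis.continuous_cdf (h : SymmetryHypothesis P) : Continuous (cdf P) := by
  refine continuous_iff_continuousAt.2 fun x => continuousAt_iff_continuous_left_right.2
    ⟨?_, (cdf P).right_continuous x⟩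
  have heq : (cdf P : ℝ → ℝ) = fun y => 1 - cdf P (-y) := by
    ext y
    linarith [h y]
  rw [heq]
  refine continuousWithinAt_const.sub ?_
  exact ((cdf P).right_continuous (-x)).comp continuous_neg.continuousWithinAt
    fun y (hy : y ≤ x) => neg_le_neg hy

lemma exists_cdf_eq (hc : Continuous (cdf P)) {u : ℝ} (h0 : 0 < u) (h1 : u < 1) :
    ∃ x, cdf P x = u := by
  obtain ⟨a, ha⟩ := ((tendsto_cdf_atBot P).eventually (gt_mem_nhds h0)).exists
  obtain ⟨b, hb⟩ := ((tendsto_cdf_atTop P).eventually (lt_mem_nhds h1)).exists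
  exact intermediate_value_univ a b hc ⟨ha.le, hb.le⟩

variable [IsProbabilityMeasure P]

lemma measureReal_cdf_le (hc : Continuous (cdf P)) {u : ℝ} (h0 : 0 ≤ u) (h1 : u < 1) :
    P.real {x | cdf P x ≤ u} = u := by
  refine le_antisymm (le_of_forall_gt_imp_ge_of_dense fun v hv => ?_) ?_
  · rcases le_or_gt 1 v with hv1 | hv1
    · exact measureReal_le_one.trans hv1
    · obtain ⟨x, hx⟩ := exists_cdf_eq hc (h0.trans_lt hv) hv1
      calc P.real {y | cdf P y ≤ u} ≤ P.real (Set.Iic x) :=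
            measureReal_mono fun y (hy : cdf P y ≤ u) =>
              ((monotone_cdf P).reflect_lt (by linarith : cdf P y < cdf P x)).le
        _ = v := by rw [← cdf_eq_real, hx]
  · rcases h0.eq_or_lt with rfl | h0
    · exact measureReal_nonneg
    · obtain ⟨x, hx⟩ := exists_cdf_eq hc h0 h1
      calc u = P.real (Set.Iic x) := by rw [← cdf_eq_real, hx]
        _ ≤ P.real {y | cdf P y ≤ u} := measureReal_mono fun y (hy : y ≤ x) =>
            (monotone_cdf P hy).trans hx.le

/-- The probability integral transform, rescaled to `[-1, 1]`. -/
lemma map_two_mul_cdf_sub_one (hc : Continuous (cdf P)) :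
    P.map (fun x => 2 * cdf P x - 1) = symmUniform := by
  have hm : Measurable fun x => 2 * cdf P x - 1 := by fun_prop
  have := Measure.isProbabilityMeasure_map (μ := P) hm.aemeasurable
  refine Measure.eq_of_cdf _ _ (StieltjesFunction.ext fun t => ?_)
  rw [cdf_eq_real, cdf_eq_real, map_measureReal_apply hm measurableSet_Iic]
  rcases lt_or_ge t (-1) with ht | ht
  · have h1 : (fun x => 2 * cdf P x - 1) ⁻¹' Set.Iic t = ∅ := by
      ext x
      simp only [Set.mem_preimage, Set.mem_Iic, Set.mem_empty_iff_false, iff_false]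
      linarith [cdf_nonneg P x]
    have h2 : symmUniform.real (Set.Iic t) ≤ 0 := by
      refine (measureReal_mono (Set.Iic_subset_Iic.2 ht.le)).trans ?_
      rw [symmUniform_real_Iic (by norm_num)]
      norm_num
    rw [h1, measureReal_empty]
    exact le_antisymm measureReal_nonneg h2
  rcases lt_or_ge t 1 with ht1 | ht1
  · rw [symmUniform_real_Iic ⟨ht, ht1.le⟩, ← measureReal_cdf_le hc (u := (1 + t) / 2)
      (by linarith) (by linarith)]
    congr 1
    ext x
    simp only [Set.mem_preimage, Set.mem_Iic, Set.mem_ofPred_eq]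
    constructor <;> intro h <;> linarith
  · have h1 : (fun x => 2 * cdf P x - 1) ⁻¹' Set.Iic t = Set.univ := by
      ext x
      simp only [Set.mem_preimage, Set.mem_Iic, Set.mem_univ, iff_true]
      linarith [cdf_le_one P x]
    have h2 : 1 ≤ symmUniform.real (Set.Iic t) := by
      refine le_trans ?_ (measureReal_mono (Set.Iic_subset_Iic.2 ht1))
      rw [symmUniform_real_Iic (by norm_num)]
      norm_num
    rw [h1, probReal_univ]
    exact le_antisymm h2 measureReal_le_one

end ProbabilityIntegralTransform

/-! ### Invariance of the kernel and asymptotic normality -/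

section Invariance

/-- The kernel only depends on the order of the entries and of their absolute values, so it is
unchanged by an odd monotone map that keeps the absolute values of the entries apart. -/
lemma symmKernel_comp_eq {k : ℕ} (hk : 1 ≤ k) {G : ℝ → ℝ} (hG : Monotone G)
    (hodd : ∀ x, G (-x) = -G x) {x : Fin (k + 1) → ℝ}
    (hx : ∀ i j, i ≠ j → |G (x i)| ≠ |G (x j)|) :
    symmKernel k (fun i => G (x i)) = symmKernel k x := by
  have : NeZero k := ⟨by omega⟩
  have h0 : G 0 = 0 := by
    have := hodd 0
    rw [neg_zero] at this
    linarith
  have habs : ∀ a, |G a| = G |a| := by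
    intro a
    rcases le_total 0 a with h | h
    · rw [abs_of_nonneg h, abs_of_nonneg (h0 ▸ hG h)]
    · rw [abs_of_nonpos h, abs_of_nonpos (h0 ▸ hG h), hodd]
  have hlt : ∀ i j, i ≠ j → (|G (x i)| < |G (x j)| ↔ |x i| < |x j|) := by
    intro i j hij
    constructor
    · intro h
      rw [habs, habs] at h
      exact hG.reflect_lt h
    · intro h
      refine lt_of_le_of_ne ?_ (hx i j hij)
      rw [habs, habs]
      exact hG h.le
  have hmin : ∀ j, (|minExcept (fun i => G (x i)) j| < |G (x j)| ↔ |minExcept x j| < |x j|) := by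
    intro j
    obtain ⟨q, hq⟩ := exists_eq_ciInf_of_finite (f := fun i => x (j.succAbove i))
    have hle : ∀ i, x (j.succAbove q) ≤ x (j.succAbove i) := fun i =>
      hq ▸ ciInf_le (Set.finite_range _).bddBelow i
    have hq' : ⨅ i, G (x (j.succAbove i)) = G (x (j.succAbove q)) :=
      le_antisymm (ciInf_le (Set.finite_range _).bddBelow q) (le_ciInf fun i => hG (hle i))
    rw [minExcept, minExcept, ← hq, hq']
    exact hlt _ _ (Fin.succAbove_ne j q)
  have hmax : ∀ j, (|maxExcept (fun i => G (x i)) j| < |G (x j)| ↔ |maxExcept x j| < |x j|) := by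
    intro j
    obtain ⟨q, hq⟩ := exists_eq_ciSup_of_finite (f := fun i => x (j.succAbove i))
    have hle : ∀ i, x (j.succAbove i) ≤ x (j.succAbove q) := fun i =>
      hq ▸ le_ciSup (f := fun i => x (j.succAbove i)) (Set.finite_range _).bddAbove i
    have hq' : ⨆ i, G (x (j.succAbove i)) = G (x (j.succAbove q)) :=
      le_antisymm (ciSup_le fun i => hG (hle i))
        (le_ciSup (f := fun i => G (x (j.succAbove i))) (Set.finite_range _).bddAbove q)
    rw [maxExcept, maxExcept, ← hq, hq']
    exact hlt _ _ (Fin.succAbove_ne j q)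
  simp only [symmKernel, hmin, hmax]

variable {Ω : Type*} [MeasurableSpace Ω] {μ : Measure Ω} [IsProbabilityMeasure μ]

lemma ae_abs_ne_abs_of_indepFun {Y Z : Ω → ℝ} (hY : HasLaw Y symmUniform μ)
    (hZ : HasLaw Z symmUniform μ) (h : IndepFun Y Z μ) : ∀ᵐ ω ∂μ, |Y ω| ≠ |Z ω| := by
  have hmap := (indepFun_iff_map_prod_eq_prod_map_map hY.aemeasurable hZ.aemeasurable).1 h
  rw [hY.map_eq, hZ.map_eq] at hmap
  have hms : MeasurableSet {p : ℝ × ℝ | |p.1| ≠ |p.2|} :=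
    (measurableSet_eq_fun (by fun_prop) (by fun_prop)).compl
  have hprod : ∀ᵐ p ∂symmUniform.prod symmUniform, |p.1| ≠ |p.2| := by
    rw [Measure.ae_prod_iff_ae_ae hms]
    refine Eventually.of_forall fun a => ?_
    filter_upwards [ae_symmUniform_ne a, ae_symmUniform_ne (-a)] with b hb hb'
    rw [ne_comm, Ne, abs_eq_abs, not_or]
    exact ⟨hb, hb'⟩
  rw [← hmap] at hprod
  exact ae_of_ae_map (hY.aemeasurable.prodMk hZ.aemeasurable) hprod

/-- The asymptotic normality of `I_n^{(k+1)}` under the hypothesis of symmetry. The statistic is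
distribution-free there, so that it suffices to treat uniform variables. -/
lemma tendstoInDistribution_sqrt_mul_integralStatistic {P : Measure ℝ} [IsProbabilityMeasure P]
    {X : ℕ → Ω → ℝ} (hP : SymmetryHypothesis P) (hlaw : ∀ i, HasLaw (X i) P μ)
    (hindep : iIndepFun X μ) {k : ℕ} (hk : 1 ≤ k) :
    TendstoInDistribution
      (fun (n : ℕ) (ω : Ω) => √(n : ℝ) * integralStatistic k n (fun i => X i ω))
      atTop (id : ℝ → ℝ) (fun _ => μ)
      (gaussianReal 0 (Real.toNNReal (((k : ℝ) + 1) ^ 2 * sigmaSq k))) := by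
  set G : ℝ → ℝ := fun x => 2 * cdf P x - 1 with hGdef
  have hGm : Measurable G :=
    ((monotone_cdf P).measurable.const_mul 2).sub_const 1
  have hGmono : Monotone G := fun a b h => by
    have := monotone_cdf P h
    simp only [hGdef]
    linarith
  have hGodd : ∀ x, G (-x) = -G x := fun x => by
    simp only [hGdef]
    linarith [hP x]
  -- The transformed variables agree almost surely with everywhere measurable ones.
  set Y : ℕ → Ω → ℝ := fun i ω => G ((hlaw i).aemeasurable.mk (X i) ω) with hYdef
  have hYX : ∀ i, Y i =ᵐ[μ] G ∘ X i := fun i => by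
    filter_upwards [(hlaw i).aemeasurable.ae_eq_mk] with ω hω
    simp only [hYdef, Function.comp_apply, hω]
  have hYm : ∀ i, Measurable (Y i) := fun i => hGm.comp (hlaw i).aemeasurable.measurable_mk
  have hGlaw : HasLaw G symmUniform P :=
    ⟨hGm.aemeasurable, map_two_mul_cdf_sub_one hP.continuous_cdf⟩
  have hYlaw : ∀ i, HasLaw (Y i) symmUniform μ := fun i => (hGlaw.comp (hlaw i)).congr (hYX i)
  have hYindep : iIndepFun Y μ :=
    (hindep.comp (fun _ => G) fun _ => hGm).congr fun i => (hYX i).symm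
  have hclt := tendstoInDistribution_sqrt_mul_uStatistic hYm hYlaw hYindep
    (measurable_symmKernel k) (abs_symmKernel_le k) (symmKernel_comp_perm k)
    (integral_projection_symmUniform hk)
  refine hclt.congr (fun n => ?_) EventuallyEq.rfl
  have hne : ∀ᵐ ω ∂μ, ∀ i j, i ≠ j → |Y i ω| ≠ |Y j ω| := by
    refine ae_all_iff.2 fun i => ae_all_iff.2 fun j => ?_
    by_cases hij : i = j
    · simp [hij]
    · filter_upwards [ae_abs_ne_abs_of_indepFun (hYlaw i) (hYlaw j) (hYindep.indepFun hij)] with ω h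
      exact fun _ => h
  filter_upwards [hne, ae_all_iff.2 hYX] with ω hω hYω
  have hker : ∀ i : Fin (k + 1) → Fin n, Function.Injective i →
      symmKernel k (fun j => Y (i j) ω) = symmKernel k (fun j => X (i j) ω) := by
    intro i hi
    simp only [hYω, Function.comp_apply] at hω ⊢
    exact symmKernel_comp_eq hk hGmono hGodd fun a b hab =>
      hω _ _ fun h => hab (hi (Fin.val_injective h))
  simp only [integralStatistic, uStatistic]
  congr 2
  exact Finset.sum_congr rfl fun i hi => hker i (Finset.mem_filter.1 hi).2.injective

end Invariance

theorem mainTheorem2 :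
    (∀ k : ℕ, 2 ≤ k →
      (∀ s ∈ Set.Icc (-1 : ℝ) 1,
        projection symmUniform (symmKernel k) s =
          if 0 < s then ((1 + s) ^ k + (1 - s) ^ k - 2) / (((k : ℝ) + 1) * 2 ^ (k - 1))
          else -(((1 + s) ^ k + (1 - s) ^ k - 2) / (((k : ℝ) + 1) * 2 ^ (k - 1)))) ∧
      (∀ j : Fin (k + 1),
        (Measure.pi fun _ : Fin (k + 1) => symmUniform)[symmKernel k |
            MeasurableSpace.comap (fun x : Fin (k + 1) → ℝ => x j) inferInstance]
          =ᵐ[Measure.pi fun _ : Fin (k + 1) => symmUniform]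
            fun x => projection symmUniform (symmKernel k) (x j)) ∧
      variance (projection symmUniform (symmKernel k)) symmUniform = sigmaSq k ∧
      sigmaSq k = (2 ^ (2 * k - 2) * ((k : ℝ) + 1) ^ 2)⁻¹ *
        ∫ s in (0 : ℝ)..1, ((1 + s) ^ k + (1 - s) ^ k - 2) ^ 2 ∧
      0 < sigmaSq k) ∧
    (sigmaSq 2 = 1 / 45 ∧ sigmaSq 3 = 9 / 320 ∧ sigmaSq 4 = 2843 / 126000 ∧
      sigmaSq 5 = 2335 / 145152 ∧ sigmaSq 6 = 421691 / 37669632) ∧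
    (∀ {Ω : Type*} [MeasurableSpace Ω] (μ : Measure Ω) [IsProbabilityMeasure μ]
      (P : Measure ℝ) [IsProbabilityMeasure P] (X : ℕ → Ω → ℝ),
      SymmetryHypothesis P → (∀ i, HasLaw (X i) P μ) → iIndepFun X μ →
      (∀ k : ℕ, 2 ≤ k →
        TendstoInDistribution
          (fun (n : ℕ) (ω : Ω) => √(n : ℝ) * integralStatistic k n (fun i => X i ω))
          atTop (id : ℝ → ℝ) (fun _ => μ)
          (gaussianReal 0 (Real.toNNReal (((k : ℝ) + 1) ^ 2 * sigmaSq k)))) ∧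
      TendstoInDistribution
        (fun (n : ℕ) (ω : Ω) => √(n : ℝ) * integralStatistic 2 n (fun i => X i ω))
        atTop (id : ℝ → ℝ) (fun _ => μ) (gaussianReal 0 (1 / 5))) := by
  refine ⟨fun k hk => ⟨fun s hs => projection_symmUniform_eq (by omega) hs, fun j =>
      condExp_eq_projection (measurable_symmKernel k) (abs_symmKernel_le k)
        (symmKernel_comp_perm k) j, variance_projection_symmUniform (by omega),
      sigmaSq_eq (by omega), sigmaSq_pos hk⟩,
    ⟨sigmaSq_two, sigmaSq_three, sigmaSq_four, sigmaSq_five, sigmaSq_six⟩, ?_⟩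
  intro Ω _ μ _ P _ X hP hlaw hindep
  refine ⟨fun k hk => tendstoInDistribution_sqrt_mul_integralStatistic hP hlaw hindep (by omega),
    ?_⟩
  have h := tendstoInDistribution_sqrt_mul_integralStatistic hP hlaw hindep one_le_two
  have hv : Real.toNNReal ((((2 : ℕ) : ℝ) + 1) ^ 2 * sigmaSq 2) = 1 / 5 := by
    rw [sigmaSq_two, show (((2 : ℕ) : ℝ) + 1) ^ 2 * (1 / 45) = ((1 / 5 : NNReal) : ℝ) by norm_num,
      Real.toNNReal_coe]
  rwa [hv] at h
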